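/- \textbf{Lemma (Descent direction property).} \emph{Setting.} Let $X,Y$ be real Banach spaces, $X$ smooth and uniformly convex, $p,q\in(1,\infty)$ with $\frac1p+\frac1q=1$, and $r\in(1,\infty)$. Let $A:X\to Y$ be linear and continuous, $y\in\mathcal R(A)$ and $M:=\{z\in X: Az=y\}$. The duality mapping with gauge $t\mapsto t^{p-1}$ is $J_p(x)=\{x^*\in X^*:\langle x^*,x\rangle=\|x\|^p,\ \|x^*\|=\|x\|^{p-1}\}$; it is single-valued on $X$. $J_q$ is the duality mapping of $X^*$ with gauge $t\mapsto t^{q-1}$, with values in $X\subset X^{**}$, and $J_Y:Y\to Y^*$ is a single-valued selection of the duality mapping of $Y$ with gauge $t\mapsto t^{r-1}$. The Bregman distance is $D_p(x,z)=\frac1p\|z\|^p-\frac1p\|x\|^p-\langle J_p(x),z-x\rangle$. \emph{Method.} Let $N_0=1$ and $1\le N_{k+1}\le N_k+1$ (for example $N_k=\min\{N,k+1\}$ with fixed $N\geq1$), and let $x_0\in X$. As long as $R_k:=\|Ax_k-y\|\ne0$, iteration $k$ has the Landweber direction $d_k=A^*J_Y(Ax_k-y)$ and the new search direction $$\psi_k=d_k-P_{V_{k-1}}(d_k)=d_k-\sum_{i}s_{k,i}\,\psi_i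 ,\qquad V_{-1}=\{0\},$$ where $V_k=\operatorname{span}\{\psi_{k-N_k+1},\dots,\psi_k\}$, $P_{V_{k-1}}(d_k)=\sum_i s_{k,i}\psi_i$ is the metric projection of $d_k$ onto $V_{k-1}$ in $X^*$, and the sum runs over $k-N_{k-1}\le i\le k-1$. Put $\omega_k=J_Y(Ax_k-y)-\sum_i s_{k,i}\,\omega_i$, so that $\psi_k=A^*\omega_k$. Write $\psi_{k,j}=\psi_{k-N_k+j}$ and $\beta_{k,j}=\langle\omega_{k-N_k+j},y\rangle$ for $1\le j\le N_k$ (so $\psi_{k,N_k}=\psi_k$), and $$h_k(t)=\tfrac1q\Big\|J_p(x_k)-\sum_{j=1}^{N_k}t_j\psi_{k,j}\Big\|^q+\sum_{j=1}^{N_k}t_j\beta_{k,j},\qquad x_{k+1}(t)=J_q\Big(J_p(x_k)-\sum_{j=1}^{N_k}t_j\psi_{k,j}\Big),\qquad t\in\mathbb R^{N_k}.$$ The next iterate is $x_{k+1}=x_{k+1}(t_k)$, where $t_k$ minimizes $h_k$ over $\mathbb R^{N_k}$. \emph{Claim.} Let $x_0,\dots,x_n$ be produced by this method with $R_k\neq0$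 for all $k\le n$. Then $\psi_{n,N_n}\ne0$, the minimizer $t_n$ of $h_n$ exists and is unique, $x_{n+1}(t)$ exists and is unique for every $t\in\mathbb R^{N_n}$, and: (1) For all $t\in\mathbb R^{N_n}$, $z\in M$ and $S\in\mathbb R$, $$h_n(t)\le h_n(0)-S\iff D_p(x_{n+1}(t),z)\le D_p(x_n,z)-S.$$ (2) $\psi_{n,N_n}$ is a descent direction: there are $\nu_n>0$ and $S_n>0$ such that $$h_n(0,\dots,0,\nu_n)\le h_n(0)-S_n,\qquad h_n(t_n)\le h_n(0)-S_n,\qquad D_p(x_{n+1},z)\le D_p(x_n,z)-S_n\quad\text{for all }z\in M .$$ (3) Assume also $\dim X\ge2$ and $x_n\ne0$, and let $\gamma\in(0,1)$. Let $\rho$ be the modulus of smoothness of $X^*$, $\rho(\tau)=\frac12\sup_{\|f\|=\|g\|=1}(\|f+\tau g\|+\|f-\tau g\|-2)$. There is $\tau_n\in(0,1]$ with $$\frac{\rho(\tau_n)}{\tau_n}=\min\Big\{\rho(1),\ \frac{\gamma}{2^qG_p}\,\frac{R_n^r}{\|x_n\|\,\|\psi_{n,N_n}\|}\Big\},$$ and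 for every such $\tau_n$ the inequalities in (2) hold with $$\nu_n=\frac{\tau_n\|x_n\|^{p-1}}{\|\psi_{n,N_n}\|},\qquad S_n=\frac{1-\gamma}{\|A\|}\,\tau_n\,\|x_n\|^{p-1}R_n>0 .$$ Here $G_p=\max\{8,\,64\,c\,K_p^{-1}\}$ with $$K_p=4(2+\sqrt3)\min\Big\{\min\{\tfrac12p(p-1),1\},\ \min\{\tfrac12p,1\}(p-1),\ (p-1)\big[1-(\sqrt3-1)^q\big],\ 1-\big[1+(2-\sqrt3)q\big]^{1-p}\Big\},$$ $$c=\frac{4\tau_0}{\sqrt{1+\tau_0^2}-1}\prod_{j=1}^\infty\Big(1+\frac{15\tau_0}{2^{j+2}}\Big),\qquad \tau_0=\frac{\sqrt{339}-18}{30}.$$ -/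

import Mathlib

noncomputable section

namespace SESOP

section Geometry

variable {E : Type*} [NormedAddCommGroup E] [NormedSpace ℝ E]

/-- The (set-valued) duality mapping of `E` with gauge function `t ↦ t ^ (p - 1)`. -/
def dualityMap (p : ℝ) (x : E) : Set (StrongDual ℝ E) :=
  {f | f x = ‖x‖ ^ p ∧ ‖f‖ = ‖x‖ ^ (p - 1)}

/-- The values of the duality mapping are nonempty (Hahn-Banach). -/
theorem dualityMap_nonempty {p : ℝ} (hp : 1 < p) (x : E) : (dualityMap p x).Nonempty := by
  by_cases hx : x = 0
  · subst hx
    refine ⟨0, ?_, ?_⟩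
    · simp [Real.zero_rpow (by linarith : p ≠ 0)]
    · simp [Real.zero_rpow (by linarith : p - 1 ≠ 0)]
  · obtain ⟨g, hg1, hg2⟩ := exists_dual_vector ℝ x (norm_ne_zero_iff.mpr hx)
    have hpos : 0 < ‖x‖ := norm_pos_iff.mpr hx
    refine ⟨(‖x‖ ^ (p - 1)) • g, ?_, ?_⟩
    · have h : ‖x‖ ^ (p - 1) * ‖x‖ = ‖x‖ ^ p := by
        rw [← Real.rpow_add_one hpos.ne']
        congr 1
        ring
      simpa [hg2] using h
    · rw [norm_smul, hg1, mul_one, Real.norm_of_nonneg (Real.rpow_nonneg hpos.le _)]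

/-- The duality mapping as a function. On a smooth space the set `dualityMap p x` has exactly one
element (for `1 < p`), and this is that element. -/
def J (p : ℝ) (x : E) : StrongDual ℝ E :=
  Classical.epsilon fun f => f ∈ dualityMap p x

theorem J_mem {p : ℝ} (hp : 1 < p) (x : E) : J p x ∈ dualityMap p x :=
  Classical.epsilon_spec (dualityMap_nonempty hp x)

/-- The duality mapping of the dual space `E*` with gauge function `t ↦ t ^ (q - 1)`, with values in
`E`, where `E` is regarded as a subspace of its bidual through the canonical embedding. -/
def dualityMapDual (q : ℝ) (f : StrongDual ℝ E) : Set E :=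
  {x | NormedSpace.inclusionInDoubleDual ℝ E x ∈ dualityMap q f}

variable (E) in
/-- Smoothness: every nonzero vector has exactly one norming functional of norm one. -/
def IsSmooth : Prop :=
  ∀ x : E, x ≠ 0 → ∃! f : StrongDual ℝ E, ‖f‖ = 1 ∧ f x = ‖x‖

/-- The Bregman distance of `x` to `y` with respect to the function `x ↦ ‖x‖ ^ p / p`, whose
Gateaux derivative on a smooth space is the duality mapping `J p`. -/
def bregmanDist (p : ℝ) (x y : E) : ℝ :=
  1 / p * ‖y‖ ^ p - 1 / p * ‖x‖ ^ p - J p x (y - x)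

variable (E) in
/-- The modulus of smoothness of `E`. -/
def modulusOfSmoothness (τ : ℝ) : ℝ :=
  1 / 2 * sSup {a : ℝ | ∃ x y : E, ‖x‖ = 1 ∧ ‖y‖ = 1 ∧ a = ‖x + τ • y‖ + ‖x - τ • y‖ - 2}

end Geometry

section Constants

/-- The number `τ₀ = (√339 - 18) / 30`. -/
def xuRoachTau : ℝ := (√339 - 18) / 30

/-- `c = 4 τ₀ / (√(1 + τ₀²) - 1) * ∏_{j ≥ 1} (1 + 15 τ₀ / 2 ^ (j + 2))`. -/
def xuRoachC : ℝ :=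
  4 * xuRoachTau / (√(1 + xuRoachTau ^ 2) - 1) *
    ∏' j : ℕ, (1 + 15 * xuRoachTau / 2 ^ ((j + 1) + 2))

/-- The constant `K_p`; the argument `q` is the conjugate exponent of `p`. -/
def xuRoachK (p q : ℝ) : ℝ :=
  4 * (2 + √3) *
    min (min (min (1 / 2 * p * (p - 1)) 1) (min (1 / 2 * p) 1 * (p - 1)))
      (min ((p - 1) * (1 - (√3 - 1) ^ q)) (1 - (1 + (2 - √3) * q) ^ (1 - p)))

/-- The Xu-Roach constant `G_p`; the argument `q` is the conjugate exponent of `p`. -/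
def xuRoachG (p q : ℝ) : ℝ := max 8 (64 * xuRoachC * (xuRoachK p q)⁻¹)

end Constants

section Method

variable {X Y : Type*} [NormedAddCommGroup X] [NormedSpace ℝ X]
  [NormedAddCommGroup Y] [NormedSpace ℝ Y]

/-- The dual point `J p x - ∑ k, t k • ψ k` reached from `x` with step vector `t` along the search
directions `ψ`. -/
def dualStep (p : ℝ) (x : X) {m : ℕ} (ψ : Fin m → StrongDual ℝ X) (t : Fin m → ℝ) :
    StrongDual ℝ X :=
  J p x - ∑ k, t k • ψ k

/-- The line search functional at `x` with search directions `ψ` and offsets `β`. -/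
def lineSearch (p q : ℝ) (x : X) {m : ℕ} (ψ : Fin m → StrongDual ℝ X) (β : Fin m → ℝ)
    (t : Fin m → ℝ) : ℝ :=
  1 / q * ‖dualStep p x ψ t‖ ^ q + ∑ k, t k * β k

/-- `t` minimizes `h` over all step vectors. -/
def IsMinimizer {m : ℕ} (h : (Fin m → ℝ) → ℝ) (t : Fin m → ℝ) : Prop :=
  ∀ t', h t ≤ h t'

/-- The step vector `(0, …, 0, ν)`. -/
def lastStep (m : ℕ) (ν : ℝ) : Fin m → ℝ :=
  fun k => if (k : ℕ) + 1 = m then ν else 0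

/-- The members of a sequence `u` that belong to the truncated window of iteration `n`:
the last `N n` of `u 0, …, u n`, in their order, so the last entry is `u n`. -/
def window {α : Type*} (N : ℕ → ℕ) (u : ℕ → α) (n : ℕ) : Fin (N n) → α :=
  fun k => u (n + 1 - N n + k)

/-- The semi-orthogonalized search directions of iteration `n`. `ω k` is the precursor of the
`k`-th direction `A* ω k`. -/
def searchDirs (A : X →L[ℝ] Y) (N : ℕ → ℕ) (ω : ℕ → StrongDual ℝ Y) (n : ℕ) :
    Fin (N n) → StrongDual ℝ X :=
  window N (fun k => (ω k).comp A) n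

/-- The hyperplane offsets of iteration `n`. -/
def offsets (y : Y) (N : ℕ → ℕ) (ω : ℕ → StrongDual ℝ Y) (n : ℕ) : Fin (N n) → ℝ :=
  window N (fun k => ω k y) n

/-- `IsRun p q A y jY N x ω s t n` says: the sequential subspace method with semi-orthogonalized
truncated search spaces for `A x = y` has not stopped up to iteration `n`, it has produced the
iterates `x 0, …, x n` with the step vectors `t 0, …, t (n - 1)`, and the search directions
`A* ω 0, …, A* ω n`, where `s k` are the coefficients of the metric projection of the
Landweber direction of iteration `k + 1` onto the span of the search directions of iteration `k`.
`jY` is the selection of the duality mapping of `Y`, and `N k` is the number of search directions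
in iteration `k`. Values of the sequences at later indices are irrelevant. -/
structure IsRun (p q : ℝ) (A : X →L[ℝ] Y) (y : Y) (jY : Y → StrongDual ℝ Y) (N : ℕ → ℕ)
    (x : ℕ → X) (ω : ℕ → StrongDual ℝ Y) (s t : ∀ k, Fin (N k) → ℝ) (n : ℕ) : Prop where
  /-- The first search space is spanned by one direction. -/
  card_zero : N 0 = 1
  /-- Each search space holds the new direction and directions of the previous search space. -/
  card_succ : ∀ k < n, 1 ≤ N (k + 1) ∧ N (k + 1) ≤ N k + 1
  /-- The stopping criterion was not met. -/
  residual_ne : ∀ k ≤ n, A (x k) - y ≠ 0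
  /-- The first direction is the Landweber direction. -/
  precursor_zero : ω 0 = jY (A (x 0) - y)
  /-- `∑ i, s k i • ψ i`, with `ψ` the directions of iteration `k`, is a best approximation of the
  Landweber direction of iteration `k + 1`. -/
  coeff_min : ∀ k < n, IsMinimizer
    (fun c => ‖(jY (A (x (k + 1)) - y)).comp A - ∑ i, c i • searchDirs A N ω k i‖ ^ q) (s k)
  /-- The new direction is the Landweber direction minus its metric projection. -/
  precursor_succ : ∀ k < n,
    ω (k + 1) = jY (A (x (k + 1)) - y) - ∑ i, s k i • window N ω k i
  /-- The step vector minimizes the line search functional. -/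
  step_min : ∀ k < n, IsMinimizer
    (lineSearch p q (x k) (searchDirs A N ω k) (offsets y N ω k)) (t k)
  /-- The update of the iterate. -/
  update : ∀ k < n, x (k + 1) ∈ dualityMapDual q (dualStep p (x k) (searchDirs A N ω k) (t k))

/-- The step `(0, …, 0, ν)` along the last direction alone decreases the line search functional at
`x` by at least `S`; hence so does the method's step (a minimizer), and the Bregman
distance to every solution decreases by at least `S` in the method's update. -/
def DescentBy (p q : ℝ) (A : X →L[ℝ] Y) (y : Y) (x : X) {m : ℕ} (ψ : Fin m → StrongDual ℝ X)
    (β : Fin m → ℝ) (ν S : ℝ) : Prop :=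
  lineSearch p q x ψ β (lastStep m ν) ≤ lineSearch p q x ψ β 0 - S ∧
  ∀ t, IsMinimizer (lineSearch p q x ψ β) t →
    lineSearch p q x ψ β t ≤ lineSearch p q x ψ β 0 - S ∧
    ∀ x' ∈ dualityMapDual q (dualStep p x ψ t), ∀ z, A z = y →
      bregmanDist p x' z ≤ bregmanDist p x z - S

/-- The condition on the step parameter `τ ∈ (0, 1]` for given `γ ∈ (0, 1)`; here `R` is the norm of
the residual at `x`, and `ψ` is the last search direction. -/
def IsStepParameter (p q r γ : ℝ) (R : ℝ) (x : X) (ψ : StrongDual ℝ X) (τ : ℝ) : Prop :=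
  0 < τ ∧ τ ≤ 1 ∧
  modulusOfSmoothness (StrongDual ℝ X) τ / τ =
    min (modulusOfSmoothness (StrongDual ℝ X) 1)
      (γ / (2 ^ q * xuRoachG p q) * (R ^ r / (‖x‖ * ‖ψ‖)))

end Method

end SESOP

end

open SESOP

/-! Write `f = J p x - ∑ k, t k • ψ k`. For a solution `z` the offsets are `β k = ψ k z`, so the
line search functional is `‖f‖ ^ q / q - f z` plus a constant. Smoothness makes `J p` invert the
duality mapping of the dual, so the Bregman distance from the point with dual `f` to `z` is again
`‖f‖ ^ q / q - f z` plus a constant. Hence both decrease by the same amount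
(`lineSearch_sub_eq_bregmanDist_sub`).

Uniform convexity makes `‖f‖ ^ q / q` Fréchet differentiable with the duality mapping as derivative.
At a minimizer the partial derivatives `β k - ψ k x'` vanish, so the new iterate lies on all
hyperplanes of its window. The old precursors therefore annihilate the next residual, and `ω n (A (x
n) - y) = R ^ r` (`precursor_apply_residual`). This one identity gives a nonzero direction and the
slope `-R ^ r` along it. The metric projection adds linear independence, hence coercivity and a
unique minimizer, and the bound `‖ψ‖ ≤ R ^ (r - 1) * ‖A‖`.

The explicit decrease needs an upper bound for `‖f - τ g‖ ^ q` with error `8 * 2 ^ q * ρ(τ)`. It is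
proved directly: the norm is within `2ρ` of its linearization, and the quadratic error is absorbed
by `τ ^ 2 ≤ 14 ρ(τ)`, which requires dimension at least two. The condition on `τ` makes the error at
most the fraction `γ` of the linear gain. -/

namespace SESOP

open Filter Topology

/-! ### Duality mappings of a uniformly convex space and of its dual -/

section Duality

variable {X : Type*} [NormedAddCommGroup X] [NormedSpace ℝ X]

theorem mem_dualityMapDual_iff {q : ℝ} {f : StrongDual ℝ X} {x : X} :
    x ∈ dualityMapDual q f ↔ f x = ‖f‖ ^ q ∧ ‖x‖ = ‖f‖ ^ (q - 1) := by
  have h : ‖NormedSpace.inclusionInDoubleDual ℝ X x‖ = ‖x‖ :=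
    (NormedSpace.inclusionInDoubleDualLi (E := X) ℝ).norm_map x
  simp only [dualityMapDual, dualityMap, Set.mem_ofPred_eq, h, NormedSpace.dual_def]

theorem exists_norm_one_lt_apply {f : StrongDual ℝ X} {a : ℝ} (ha0 : 0 ≤ a) (ha : a < ‖f‖) :
    ∃ u : X, ‖u‖ = 1 ∧ a < f u := by
  obtain ⟨x, hx1, hx2⟩ := f.exists_lt_apply_of_lt_opNorm ha
  wlog h : 0 ≤ f x generalizing x
  · exact this (-x) (by simpa using hx1) (by simpa using hx2) (by simp; linarith)
  rw [Real.norm_of_nonneg h] at hx2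
  have hx : x ≠ 0 := by
    rintro rfl
    simp at hx2
    linarith
  have hpos : 0 < ‖x‖ := norm_pos_iff.mpr hx
  refine ⟨‖x‖⁻¹ • x, by rw [norm_smul, norm_inv, norm_norm, inv_mul_cancel₀ hpos.ne'], ?_⟩
  rw [map_smul, smul_eq_mul]
  have : 1 ≤ ‖x‖⁻¹ := (one_le_inv₀ hpos).mpr hx1.le
  nlinarith

/-- In a uniformly convex space, almost norming unit vectors of a functional are close. -/
theorem exists_lt_norm_forall_norming_close [UniformConvexSpace X] {f : StrongDual ℝ X}
    (hf : f ≠ 0) {ε : ℝ} (hε : 0 < ε) :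
    ∃ η < ‖f‖, ∀ u v : X, ‖u‖ = 1 → ‖v‖ = 1 → η < f u → η < f v → ‖u - v‖ < ε := by
  obtain ⟨δ, hδ, h⟩ := exists_forall_sphere_dist_add_le_two_sub X hε
  have hpos : 0 < ‖f‖ := norm_pos_iff.mpr hf
  -- Two values above this threshold force `‖u + v‖ > 2 - δ`, which uniform convexity forbids for
  -- `ε`-separated unit vectors.
  refine ⟨‖f‖ * (1 - δ / 2), by nlinarith, fun u v hu hv hfu hfv => ?_⟩
  by_contra! hcon
  have h1 := h hu hv hcon
  have h2 : f (u + v) ≤ ‖f‖ * ‖u + v‖ := (le_abs_self _).trans (f.le_opNorm _)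
  rw [map_add] at h2
  nlinarith

/-- Every maximizing sequence of unit vectors is Cauchy by uniform convexity, so completeness yields
a norming vector. -/
theorem exists_norm_one_apply_eq_norm [CompleteSpace X] [UniformConvexSpace X]
    {f : StrongDual ℝ X} (hf : f ≠ 0) : ∃ u : X, ‖u‖ = 1 ∧ f u = ‖f‖ := by
  have hpos : 0 < ‖f‖ := norm_pos_iff.mpr hf
  have hlt : ∀ n : ℕ, ∃ u : X, ‖u‖ = 1 ∧ ‖f‖ * (1 - 1 / (n + 1 : ℝ)) < f u := fun n => by
    have h1 : (0 : ℝ) < 1 / (n + 1 : ℝ) := by positivity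
    have h2 : 1 / (n + 1 : ℝ) ≤ 1 := by
      rw [div_le_one (by positivity)]
      have : (0 : ℝ) ≤ n := n.cast_nonneg
      linarith
    exact exists_norm_one_lt_apply (by nlinarith) (by nlinarith)
  choose u hu1 hu2 using hlt
  have hlim : Tendsto (fun n : ℕ => ‖f‖ * (1 - 1 / (n + 1 : ℝ))) atTop (𝓝 ‖f‖) := by
    simpa using (tendsto_one_div_add_atTop_nhds_zero_nat (𝕜 := ℝ)).const_sub 1 |>.const_mul ‖f‖
  have hcauchy : CauchySeq u := by
    rw [Metric.cauchySeq_iff]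
    intro ε hε
    obtain ⟨η, hη, h⟩ := exists_lt_norm_forall_norming_close hf hε
    obtain ⟨n₀, hn₀⟩ := eventually_atTop.mp (hlim.eventually_const_lt hη)
    refine ⟨n₀, fun m hm k hk => ?_⟩
    rw [dist_eq_norm]
    exact h _ _ (hu1 m) (hu1 k) ((hn₀ m hm).trans (hu2 m)) ((hn₀ k hk).trans (hu2 k))
  obtain ⟨v, hv⟩ := cauchySeq_tendsto_of_complete hcauchy
  have hv1 : ‖v‖ = 1 := tendsto_nhds_unique hv.norm (by simp [hu1])
  refine ⟨v, hv1, le_antisymm ?_ ?_⟩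
  · simpa [hv1] using (le_abs_self _).trans (f.le_opNorm v)
  · exact le_of_tendsto_of_tendsto' hlim ((f.continuous.tendsto v).comp hv) fun n => (hu2 n).le

theorem rpow_sub_one_mul_self {a : ℝ} (ha : 0 ≤ a) {q : ℝ} (hq : 1 < q) :
    a ^ (q - 1) * a = a ^ q := by
  rcases ha.eq_or_lt with rfl | h
  · simp [Real.zero_rpow (by linarith : q ≠ 0)]
  · rw [← Real.rpow_add_one h.ne', sub_add_cancel]

theorem eq_zero_of_mem_dualityMapDual_zero {q : ℝ} (hq : 1 < q) {x : X}
    (hx : x ∈ dualityMapDual q (0 : StrongDual ℝ X)) : x = 0 := by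
  have := (mem_dualityMapDual_iff.mp hx).2
  rwa [norm_zero, Real.zero_rpow (by linarith), norm_eq_zero] at this

theorem exists_norming_of_mem_dualityMapDual {q : ℝ} (hq : 1 < q) {f : StrongDual ℝ X}
    (hf : f ≠ 0) {x : X} (hx : x ∈ dualityMapDual q f) :
    ∃ u : X, ‖u‖ = 1 ∧ f u = ‖f‖ ∧ x = ‖f‖ ^ (q - 1) • u := by
  obtain ⟨h1, h2⟩ := mem_dualityMapDual_iff.mp hx
  have hpos : 0 < ‖f‖ := norm_pos_iff.mpr hf
  have ha : 0 < ‖f‖ ^ (q - 1) := Real.rpow_pos_of_pos hpos _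
  refine ⟨(‖f‖ ^ (q - 1))⁻¹ • x, ?_, ?_, ?_⟩
  · rw [norm_smul, norm_inv, Real.norm_of_nonneg ha.le, h2, inv_mul_cancel₀ ha.ne']
  · rw [map_smul, smul_eq_mul, h1, ← rpow_sub_one_mul_self hpos.le hq,
      inv_mul_cancel_left₀ ha.ne']
  · rw [smul_inv_smul₀ ha.ne']

theorem exists_mem_dualityMapDual [CompleteSpace X] [UniformConvexSpace X] {q : ℝ} (hq : 1 < q)
    (f : StrongDual ℝ X) : ∃ x, x ∈ dualityMapDual q f := by
  by_cases hf : f = 0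
  · refine ⟨0, mem_dualityMapDual_iff.mpr ?_⟩
    simp [hf, Real.zero_rpow (by linarith : q ≠ 0), Real.zero_rpow (by linarith : q - 1 ≠ 0)]
  · obtain ⟨u, hu1, hu2⟩ := exists_norm_one_apply_eq_norm hf
    refine ⟨‖f‖ ^ (q - 1) • u, mem_dualityMapDual_iff.mpr ⟨?_, ?_⟩⟩
    · rw [map_smul, hu2, smul_eq_mul, rpow_sub_one_mul_self (norm_nonneg _) hq]
    · rw [norm_smul, hu1, mul_one, Real.norm_of_nonneg (Real.rpow_nonneg (norm_nonneg _) _)]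

theorem existsUnique_mem_dualityMapDual [CompleteSpace X] [UniformConvexSpace X] {q : ℝ}
    (hq : 1 < q) (f : StrongDual ℝ X) : ∃! x, x ∈ dualityMapDual q f := by
  obtain ⟨x, hx⟩ := exists_mem_dualityMapDual hq f
  refine ⟨x, hx, fun x' hx' => ?_⟩
  by_cases hf : f = 0
  · subst hf
    rw [eq_zero_of_mem_dualityMapDual_zero hq hx, eq_zero_of_mem_dualityMapDual_zero hq hx']
  · obtain ⟨u, hu1, hu2, rfl⟩ := exists_norming_of_mem_dualityMapDual hq hf hx
    obtain ⟨v, hv1, hv2, rfl⟩ := exists_norming_of_mem_dualityMapDual hq hf hx'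
    congr 1
    rw [← sub_eq_zero, ← norm_eq_zero]
    refine le_antisymm (le_of_forall_pos_lt_add fun ε hε => ?_) (norm_nonneg _)
    obtain ⟨η, hη, h⟩ := exists_lt_norm_forall_norming_close hf hε
    simpa using h v u hv1 hu1 (hv2 ▸ hη) (hu2 ▸ hη)

/-- The duality mapping of the dual of a uniformly convex space is norm-to-norm continuous. -/
theorem continuous_of_mem_dualityMapDual [UniformConvexSpace X] {q : ℝ}
    (hq : 1 < q) {j : StrongDual ℝ X → X} (hj : ∀ f, j f ∈ dualityMapDual q f) :
    Continuous j := by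
  rw [continuous_iff_continuousAt]
  intro f
  have hq1 : q - 1 ≠ 0 := by linarith
  have hnorm : Continuous fun f' : StrongDual ℝ X => ‖f'‖ ^ (q - 1) :=
    continuous_norm.rpow_const fun _ => Or.inr (by linarith)
  by_cases hf : f = 0
  · subst hf
    rw [ContinuousAt, eq_zero_of_mem_dualityMapDual_zero hq (hj 0), tendsto_zero_iff_norm_tendsto_zero]
    have : (fun f' => ‖j f'‖) = fun f' : StrongDual ℝ X => ‖f'‖ ^ (q - 1) :=
      funext fun f' => (mem_dualityMapDual_iff.mp (hj f')).2
    rw [this]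
    simpa [Real.zero_rpow hq1] using hnorm.tendsto (0 : StrongDual ℝ X)
  · have hex : ∀ f' : StrongDual ℝ X, ∃ u : X, f' ≠ 0 →
        ‖u‖ = 1 ∧ f' u = ‖f'‖ ∧ j f' = ‖f'‖ ^ (q - 1) • u := fun f' => by
      by_cases h : f' = 0
      · exact ⟨0, fun h' => absurd h h'⟩
      · obtain ⟨u, hu⟩ := exists_norming_of_mem_dualityMapDual hq h (hj f')
        exact ⟨u, fun _ => hu⟩
    choose u hu using hex
    have hne : ∀ᶠ f' in 𝓝 f, f' ≠ 0 := isOpen_ne.mem_nhds hf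
    have hucont : ContinuousAt u f := by
      rw [ContinuousAt, Metric.tendsto_nhds]
      intro ε hε
      obtain ⟨η, hη, h⟩ := exists_lt_norm_forall_norming_close hf hε
      -- This expression bounds `f (u f')` from below, so near `f` the vector `u f'` almost norms
      -- `f` and must be close to `u f`.
      have hlim : Tendsto (fun f' : StrongDual ℝ X => ‖f'‖ - ‖f' - f‖) (𝓝 f) (𝓝 ‖f‖) := by
        have : Continuous fun f' : StrongDual ℝ X => ‖f'‖ - ‖f' - f‖ := by fun_prop
        simpa using this.tendsto f
      filter_upwards [hne, hlim.eventually_const_lt hη] with f' hf' hη'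
      obtain ⟨h1, h2, -⟩ := hu f' hf'
      obtain ⟨h3, h4, -⟩ := hu f hf
      rw [dist_eq_norm]
      refine h _ _ h1 h3 (hη'.trans_le ?_) (h4 ▸ hη)
      have h5 : (f' - f) (u f') ≤ ‖f' - f‖ * ‖u f'‖ := (le_abs_self _).trans ((f' - f).le_opNorm _)
      rw [sub_apply, h2, h1] at h5
      linarith
    have hprod : ContinuousAt (fun f' => ‖f'‖ ^ (q - 1) • u f') f := hnorm.continuousAt.smul hucont
    refine hprod.congr ?_
    filter_upwards [hne] with f' hf' using (hu f' hf').2.2.symm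

theorem norm_rpow_eq_of_mem_dualityMapDual {p q : ℝ} (hpq : p.HolderConjugate q)
    {f : StrongDual ℝ X} {x : X} (hx : x ∈ dualityMapDual q f) : ‖x‖ ^ p = ‖f‖ ^ q := by
  rw [(mem_dualityMapDual_iff.mp hx).2, ← Real.rpow_mul (norm_nonneg _), hpq.symm.sub_one_mul_conj]

/-- The subgradient inequality for `‖f‖ ^ q / q`. -/
theorem apply_sub_le_of_mem_dualityMapDual {p q : ℝ} (hpq : p.HolderConjugate q)
    {f : StrongDual ℝ X} {x : X} (hx : x ∈ dualityMapDual q f) (f' : StrongDual ℝ X) :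
    (f' - f) x ≤ 1 / q * ‖f'‖ ^ q - 1 / q * ‖f‖ ^ q := by
  have h1 : f' x ≤ ‖f'‖ * ‖x‖ := (le_abs_self _).trans (f'.le_opNorm _)
  have h2 := Real.young_inequality_of_nonneg (norm_nonneg f') (norm_nonneg x) hpq.symm
  rw [norm_rpow_eq_of_mem_dualityMapDual hpq hx] at h2
  rw [sub_apply, (mem_dualityMapDual_iff.mp hx).1]
  have h3 : ‖f‖ ^ q = 1 / p * ‖f‖ ^ q + 1 / q * ‖f‖ ^ q := by
    rw [← add_mul, one_div, one_div, hpq.inv_add_inv_eq_one, one_mul]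
  have e1 : ‖f'‖ ^ q / q = 1 / q * ‖f'‖ ^ q := by ring
  have e2 : ‖f‖ ^ q / p = 1 / p * ‖f‖ ^ q := by ring
  linarith

/-- On the dual of a uniformly convex space, `‖f‖ ^ q / q` is Fréchet differentiable and its
derivative is the duality mapping. -/
theorem hasFDerivAt_norm_rpow_of_mem_dualityMapDual [CompleteSpace X] [UniformConvexSpace X]
    {p q : ℝ} (hpq : p.HolderConjugate q) {f : StrongDual ℝ X} {x : X}
    (hx : x ∈ dualityMapDual q f) :
    HasFDerivAt (fun f' : StrongDual ℝ X => 1 / q * ‖f'‖ ^ q)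
      (NormedSpace.inclusionInDoubleDual ℝ X x) f := by
  choose j hj using fun f' : StrongDual ℝ X => exists_mem_dualityMapDual hpq.symm.lt f'
  have hcont := (continuous_of_mem_dualityMapDual hpq.symm.lt hj).tendsto f
  rw [← (existsUnique_mem_dualityMapDual hpq.symm.lt f).unique hx (hj f)] at hcont
  rw [hasFDerivAt_iff_isLittleO, Asymptotics.isLittleO_iff]
  intro c hc
  filter_upwards [Metric.tendsto_nhds.mp hcont c hc] with f' hf'
  rw [dist_eq_norm] at hf'
  -- The subgradient inequalities at `f` and at `f'` trap the remainder between `0` and `(f' - f) (j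
  -- f' - x)`; continuity of `j` makes the latter small.
  have h1 := apply_sub_le_of_mem_dualityMapDual hpq hx f'
  have h2 := apply_sub_le_of_mem_dualityMapDual hpq (hj f') f
  have h3 : (f' - f) (j f' - x) ≤ ‖f' - f‖ * ‖j f' - x‖ :=
    (le_abs_self _).trans ((f' - f).le_opNorm _)
  have h4 : ‖f' - f‖ * ‖j f' - x‖ ≤ c * ‖f' - f‖ := by
    rw [mul_comm]
    gcongr
  rw [NormedSpace.dual_def, Real.norm_eq_abs, abs_le]
  rw [map_sub] at h3
  simp only [sub_apply] at h1 h2 h3 ⊢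
  constructor <;> nlinarith [norm_nonneg (f' - f)]

theorem dualityMap_subsingleton (hX : IsSmooth X) {p : ℝ} (hp : 1 < p) {x : X}
    {f g : StrongDual ℝ X} (hf : f ∈ dualityMap p x) (hg : g ∈ dualityMap p x) : f = g := by
  by_cases hx : x = 0
  · have h0 : ∀ f ∈ dualityMap p x, f = 0 := fun f hf => by
      have := hf.2
      rwa [hx, norm_zero, Real.zero_rpow (by linarith), norm_eq_zero] at this
    rw [h0 f hf, h0 g hg]
  · have hpos : 0 < ‖x‖ := norm_pos_iff.mpr hx
    have ha : 0 < ‖x‖ ^ (p - 1) := Real.rpow_pos_of_pos hpos _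
    have key : ∀ f ∈ dualityMap p x,
        ‖(‖x‖ ^ (p - 1))⁻¹ • f‖ = 1 ∧ ((‖x‖ ^ (p - 1))⁻¹ • f) x = ‖x‖ := fun f hf => by
      constructor
      · rw [norm_smul, norm_inv, Real.norm_of_nonneg ha.le, hf.2, inv_mul_cancel₀ ha.ne']
      · rw [smul_apply, smul_eq_mul, hf.1,
          ← rpow_sub_one_mul_self hpos.le hp, inv_mul_cancel_left₀ ha.ne']
    exact smul_right_injective _ (inv_ne_zero ha.ne') ((hX x hx).unique (key f hf) (key g hg))

/-- The two gauges are inverse to each other because `(p - 1) * (q - 1) = 1`. -/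
theorem mem_dualityMap_of_mem_dualityMapDual {p q : ℝ} (hpq : p.HolderConjugate q)
    {f : StrongDual ℝ X} {x : X} (hx : x ∈ dualityMapDual q f) : f ∈ dualityMap p x := by
  refine ⟨?_, ?_⟩
  · rw [norm_rpow_eq_of_mem_dualityMapDual hpq hx, (mem_dualityMapDual_iff.mp hx).1]
  · rw [(mem_dualityMapDual_iff.mp hx).2, ← Real.rpow_mul (norm_nonneg _)]
    have : (q - 1) * (p - 1) = 1 := by
      have := hpq.mul_eq_add
      linarith
    rw [this, Real.rpow_one]

theorem mem_dualityMapDual_of_mem_dualityMap {p q : ℝ} (hpq : p.HolderConjugate q)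
    {f : StrongDual ℝ X} {x : X} (hf : f ∈ dualityMap p x) : x ∈ dualityMapDual q f := by
  rw [mem_dualityMapDual_iff, hf.1, hf.2, ← Real.rpow_mul (norm_nonneg _),
    ← Real.rpow_mul (norm_nonneg _), hpq.sub_one_mul_conj]
  have : (p - 1) * (q - 1) = 1 := by
    have := hpq.mul_eq_add
    linarith
  rw [this, Real.rpow_one]
  exact ⟨rfl, rfl⟩

theorem J_eq_of_mem_dualityMapDual (hX : IsSmooth X) {p q : ℝ} (hpq : p.HolderConjugate q)
    {f : StrongDual ℝ X} {x : X} (hx : x ∈ dualityMapDual q f) : J p x = f :=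
  dualityMap_subsingleton hX hpq.lt (J_mem hpq.lt x) (mem_dualityMap_of_mem_dualityMapDual hpq hx)

theorem mem_dualityMapDual_J {p q : ℝ} (hpq : p.HolderConjugate q) (x : X) :
    x ∈ dualityMapDual q (J p x) :=
  mem_dualityMapDual_of_mem_dualityMap hpq (J_mem hpq.lt x)

end Duality

/-! ### Modulus of smoothness and a quadratic lower bound -/

section Modulus

variable {E : Type*} [NormedAddCommGroup E] [NormedSpace ℝ E]

theorem norm_add_smul_add_norm_sub_smul_sub_two_le {x y : E} (hx : ‖x‖ = 1) (hy : ‖y‖ = 1) (τ : ℝ) :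
    ‖x + τ • y‖ + ‖x - τ • y‖ - 2 ≤ 2 * |τ| := by
  have h1 := norm_add_le x (τ • y)
  have h2 := norm_sub_le x (τ • y)
  rw [norm_smul, hx, hy, Real.norm_eq_abs] at h1 h2
  linarith

variable (E) in
theorem bddAbove_modulusOfSmoothness (τ : ℝ) :
    BddAbove {a : ℝ | ∃ x y : E, ‖x‖ = 1 ∧ ‖y‖ = 1 ∧ a = ‖x + τ • y‖ + ‖x - τ • y‖ - 2} := by
  refine ⟨2 * |τ|, ?_⟩
  rintro a ⟨x, y, hx, hy, rfl⟩
  exact norm_add_smul_add_norm_sub_smul_sub_two_le hx hy τ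

theorem norm_add_smul_add_norm_sub_smul_le {x y : E} (hx : ‖x‖ = 1) (hy : ‖y‖ = 1) (τ : ℝ) :
    ‖x + τ • y‖ + ‖x - τ • y‖ ≤ 2 + 2 * modulusOfSmoothness E τ := by
  have := le_csSup (bddAbove_modulusOfSmoothness E τ) ⟨x, y, hx, hy, rfl⟩
  rw [modulusOfSmoothness]
  linarith

theorem modulusOfSmoothness_le [Nontrivial E] {τ b : ℝ}
    (h : ∀ x y : E, ‖x‖ = 1 → ‖y‖ = 1 → ‖x + τ • y‖ + ‖x - τ • y‖ ≤ 2 + 2 * b) :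
    modulusOfSmoothness E τ ≤ b := by
  obtain ⟨x, hx⟩ := exists_norm_eq E zero_le_one
  have : sSup {a : ℝ | ∃ x y : E, ‖x‖ = 1 ∧ ‖y‖ = 1 ∧ a = ‖x + τ • y‖ + ‖x - τ • y‖ - 2} ≤ 2 * b := by
    refine csSup_le ⟨_, x, x, hx, hx, rfl⟩ ?_
    rintro a ⟨x, y, hx, hy, rfl⟩
    linarith [h x y hx hy]
  rw [modulusOfSmoothness]
  linarith

variable (E) in
theorem modulusOfSmoothness_le_add [Nontrivial E] (τ σ : ℝ) :
    modulusOfSmoothness E τ ≤ modulusOfSmoothness E σ + |τ - σ| := by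
  refine modulusOfSmoothness_le fun x y hx hy => ?_
  have h := norm_add_smul_add_norm_sub_smul_le hx hy σ
  have hn : ‖(τ - σ) • y‖ = |τ - σ| := by rw [norm_smul, hy, mul_one, Real.norm_eq_abs]
  have h1 : ‖x + τ • y‖ ≤ ‖x + σ • y‖ + |τ - σ| := by
    rw [← hn]
    refine le_trans (le_of_eq ?_) (norm_add_le _ _)
    congr 1
    module
  have h2 : ‖x - τ • y‖ ≤ ‖x - σ • y‖ + |τ - σ| := by
    rw [← hn]
    refine le_trans (le_of_eq ?_) (norm_sub_le _ _)
    congr 1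
    module
  linarith

variable (E) in
theorem continuous_modulusOfSmoothness [Nontrivial E] : Continuous (modulusOfSmoothness E) := by
  refine (LipschitzWith.of_dist_le_mul (K := 1) fun τ σ => ?_).continuous
  rw [Real.dist_eq, Real.dist_eq, NNReal.coe_one, one_mul, abs_le]
  have h1 := modulusOfSmoothness_le_add E τ σ
  have h2 := modulusOfSmoothness_le_add E σ τ
  rw [abs_sub_comm] at h2
  constructor <;> linarith

/-- Scaling gives the bound for the step `τ * ‖u‖`. The left side is even and convex in the step, so
the shorter step `τ` does no worse; the weights `(1 ± M⁻¹) / 2` express this. -/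
theorem norm_add_smul_add_norm_sub_smul_le_of_one_le {u z : E} (hu : 1 ≤ ‖u‖) (hz : ‖z‖ = 1)
    (τ : ℝ) :
    ‖u + τ • z‖ + ‖u - τ • z‖ ≤ 2 * (1 + modulusOfSmoothness E τ) * ‖u‖ := by
  set M := ‖u‖ with hM
  have hM0 : 0 < M := by linarith
  have hv : ‖M⁻¹ • u‖ = 1 := by
    rw [norm_smul, norm_inv, Real.norm_of_nonneg hM0.le, inv_mul_cancel₀ hM0.ne']
  have h := norm_add_smul_add_norm_sub_smul_le hv hz τ
  have e1 : M * ‖M⁻¹ • u + τ • z‖ = ‖u + (τ * M) • z‖ := by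
    rw [← Real.norm_of_nonneg hM0.le, ← norm_smul, Real.norm_of_nonneg hM0.le, smul_add,
      smul_inv_smul₀ hM0.ne', smul_smul, mul_comm]
  have e2 : M * ‖M⁻¹ • u - τ • z‖ = ‖u - (τ * M) • z‖ := by
    rw [← Real.norm_of_nonneg hM0.le, ← norm_smul, Real.norm_of_nonneg hM0.le, smul_sub,
      smul_inv_smul₀ hM0.ne', smul_smul, mul_comm]
  have hM1 : M⁻¹ ≤ 1 := inv_le_one_of_one_le₀ hu
  have hM2 : 0 < M⁻¹ := inv_pos.mpr hM0
  have hcomb : ∀ a b : E, ‖((1 + M⁻¹) / 2) • a + ((1 - M⁻¹) / 2) • b‖ ≤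
      (1 + M⁻¹) / 2 * ‖a‖ + (1 - M⁻¹) / 2 * ‖b‖ := fun a b => by
    refine (norm_add_le _ _).trans ?_
    rw [norm_smul, norm_smul, Real.norm_of_nonneg (by linarith), Real.norm_of_nonneg (by linarith)]
  have hM3 : τ = τ * M * M⁻¹ := by field_simp
  have c1 : ‖u + τ • z‖ ≤
      (1 + M⁻¹) / 2 * ‖u + (τ * M) • z‖ + (1 - M⁻¹) / 2 * ‖u - (τ * M) • z‖ := by
    refine le_trans (le_of_eq ?_) (hcomb _ _)
    congr 1
    nth_rw 1 [hM3]
    module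
  have c2 : ‖u - τ • z‖ ≤
      (1 + M⁻¹) / 2 * ‖u - (τ * M) • z‖ + (1 - M⁻¹) / 2 * ‖u + (τ * M) • z‖ := by
    refine le_trans (le_of_eq ?_) (hcomb _ _)
    congr 1
    nth_rw 1 [hM3]
    module
  have h' := mul_le_mul_of_nonneg_left h hM0.le
  rw [mul_add, e1, e2] at h'
  linarith

/-- If `Φ` starts flat at `1` and has relative second differences at most `2 * ε`, then it
stays below `s` up to index `K`, as long as `1 + ε * s * K ^ 2 ≤ s`. -/
theorem le_one_add_of_second_difference_le {Φ : ℕ → ℝ} {ε s : ℝ} {K : ℕ} (hε : 0 ≤ ε)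
    (hs : 1 ≤ s) (h0 : Φ 0 = 1) (h1 : Φ 1 ≤ 1 + ε)
    (h2 : ∀ k, Φ (k + 2) + Φ k ≤ 2 * (1 + ε) * Φ (k + 1)) (hK : 1 + ε * s * K ^ 2 ≤ s) :
    ∀ k ≤ K, Φ k ≤ 1 + ε * s * k ^ 2 := by
  -- Value and first difference are bounded together: while `Φ (k + 1) ≤ s`, the second difference
  -- is at most `2 * ε * s`, and `hK` preserves the bound `s`.
  have key : ∀ k : ℕ, k + 1 ≤ K → Φ (k + 1) ≤ 1 + ε * s * (k + 1) ^ 2 ∧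
      Φ (k + 1) - Φ k ≤ ε * s * (2 * k + 1) := by
    intro k
    induction k with
    | zero =>
      intro _
      have : ε ≤ ε * s := le_mul_of_one_le_right hε hs
      simp only [zero_add, Nat.cast_zero, one_pow, mul_zero, mul_one, h0]
      constructor <;> linarith
    | succ k ih =>
      intro hk
      obtain ⟨ih1, ih2⟩ := ih (by omega)
      have hle : ((k : ℝ) + 1) ^ 2 ≤ (K : ℝ) ^ 2 := by
        have : ((k + 1 : ℕ) : ℝ) ≤ K := by exact_mod_cast (by omega : k + 1 ≤ K)
        push_cast at this
        gcongr
      have hs' : Φ (k + 1) ≤ s := by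
        have : ε * s * ((k : ℝ) + 1) ^ 2 ≤ ε * s * (K : ℝ) ^ 2 := by gcongr
        linarith
      have h3 : ε * Φ (k + 1) ≤ ε * s := by gcongr
      have h4 := h2 k
      push_cast
      constructor <;> nlinarith
  intro k hk
  rcases k with _ | k
  · simp [h0]
  · exact_mod_cast (key k hk).1

/-- A weak form of Nordlander's inequality. -/
theorem sq_le_mul_modulusOfSmoothness {x z : E} (hx : ‖x‖ = 1) (hz : ‖z‖ = 1)
    (horth : ∀ a : ℝ, 1 ≤ ‖x + a • z‖) {τ : ℝ} (hτ0 : 0 < τ) (hτ1 : τ ≤ 1) :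
    τ ^ 2 ≤ 14 * modulusOfSmoothness E τ := by
  set ε := modulusOfSmoothness E τ with hεdef
  by_contra! hcon
  have horth' : ∀ a : ℝ, 1 ≤ ‖x - a • z‖ := fun a => by simpa [sub_eq_add_neg] using horth (-a)
  have hε : 0 ≤ ε := by
    have := norm_add_smul_add_norm_sub_smul_le hx hz τ
    linarith [horth τ, horth' τ]
  -- Orthogonality keeps all points `x ± kτ z` outside the open unit ball, so a small `ρ(τ)` keeps
  -- `Φ` nearly flat. Yet `Φ k ≥ kτ` by the triangle inequality.
  set Φ : ℕ → ℝ := fun k => (‖x + (k * τ) • z‖ + ‖x - (k * τ) • z‖) / 2 with hΦ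
  have h0 : Φ 0 = 1 := by simp [hΦ, hx]
  have h1 : Φ 1 ≤ 1 + ε := by
    have := norm_add_smul_add_norm_sub_smul_le hx hz τ
    simp only [hΦ, Nat.cast_one, one_mul]
    linarith
  have h2 : ∀ k, Φ (k + 2) + Φ k ≤ 2 * (1 + ε) * Φ (k + 1) := fun k => by
    have a1 := norm_add_smul_add_norm_sub_smul_le_of_one_le (horth ((k + 1 : ℕ) * τ)) hz τ
    have a2 := norm_add_smul_add_norm_sub_smul_le_of_one_le (horth' ((k + 1 : ℕ) * τ)) hz τ
    have e1 : x + (((k + 1 : ℕ) : ℝ) * τ) • z + τ • z = x + (((k + 2 : ℕ) : ℝ) * τ) • z := by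
      push_cast; module
    have e2 : x + (((k + 1 : ℕ) : ℝ) * τ) • z - τ • z = x + ((k : ℝ) * τ) • z := by
      push_cast; module
    have e3 : x - (((k + 1 : ℕ) : ℝ) * τ) • z + τ • z = x - ((k : ℝ) * τ) • z := by
      push_cast; module
    have e4 : x - (((k + 1 : ℕ) : ℝ) * τ) • z - τ • z = x - (((k + 2 : ℕ) : ℝ) * τ) • z := by
      push_cast; module
    rw [e1, e2, ← hεdef] at a1
    rw [e3, e4, ← hεdef] at a2
    simp only [hΦ]
    linarith
  have h3 : ∀ k : ℕ, k * τ ≤ Φ k := fun k => by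
    have hk : 0 ≤ k * τ := by positivity
    have : ‖(2 * (k * τ)) • z‖ ≤ ‖x + (k * τ) • z‖ + ‖x - (k * τ) • z‖ := by
      refine le_trans (le_of_eq ?_) (norm_sub_le _ _)
      congr 1
      module
    rw [norm_smul, hz, Real.norm_of_nonneg (by positivity)] at this
    simp only [hΦ]
    linarith
  -- This puts `s = K * τ` into `[3/2, 5/2]`, where `1 + s ^ 3 / 14 < s`; the constant 14 is small
  -- enough for the final estimate and large enough here.
  set K := ⌈3 / 2 / τ⌉₊ with hK
  have hK1 : 3 / 2 ≤ K * τ := by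
    rw [← div_le_iff₀ hτ0]
    exact Nat.le_ceil _
  have hK2 : K * τ ≤ 5 / 2 := by
    have : (K : ℝ) < 3 / 2 / τ + 1 := Nat.ceil_lt_add_one (by positivity)
    have h4 : (K : ℝ) * τ < (3 / 2 / τ + 1) * τ := by gcongr
    rw [add_mul, div_mul_cancel₀ _ hτ0.ne'] at h4
    linarith
  set s := (K : ℝ) * τ with hs
  have hKs : ε * s * K ^ 2 ≤ s ^ 3 / 14 := by
    have : s ^ 3 / 14 = τ ^ 2 / 14 * s * K ^ 2 := by rw [hs]; ring
    rw [this]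
    gcongr
    linarith
  have hs3 : 1 + s ^ 3 / 14 < s := by nlinarith [mul_nonneg (sub_nonneg.2 hK1) (sub_nonneg.2 hK2)]
  have := le_one_add_of_second_difference_le (s := s) hε (by linarith) h0 h1 h2 (by linarith) K le_rfl
  linarith [h3 K]

end Modulus

/-! ### Smoothness of the dual space -/

section DualModulus

variable {X : Type*} [NormedAddCommGroup X] [NormedSpace ℝ X]

/-- If `f` norms the unit vector `u` and `g` vanishes at `u`, then `f + a • g` still takes the value
1 at `u`. The second dimension supplies a nonzero such `g`. -/
theorem exists_dual_orthogonal_pair (hdim : 2 ≤ Module.rank ℝ X) :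
    ∃ f g : StrongDual ℝ X, ‖f‖ = 1 ∧ ‖g‖ = 1 ∧ ∀ a : ℝ, 1 ≤ ‖f + a • g‖ := by
  have : Nontrivial X := by
    rw [← rank_pos_iff_nontrivial (R := ℝ)]
    exact lt_of_lt_of_le (by norm_num) hdim
  obtain ⟨u, hu⟩ := exists_norm_eq X zero_le_one
  obtain ⟨f, hf1, hf2⟩ := exists_dual_vector' ℝ u
  obtain ⟨b, hb⟩ : ∃ b : X, b ∉ Submodule.span ℝ {u} := by
    by_contra! h
    have htop : Submodule.span ℝ {u} = ⊤ := Submodule.eq_top_iff'.mpr h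
    have h1 := rank_span_le (R := ℝ) ({u} : Set X)
    rw [htop, rank_top, Cardinal.mk_singleton] at h1
    exact absurd (hdim.trans h1) (by norm_num)
  set b' := b - f b • u with hb'
  have hb'0 : b' ≠ 0 := fun h => hb <| by
    rw [sub_eq_zero.mp h]
    exact Submodule.smul_mem _ _ (Submodule.mem_span_singleton_self u)
  simp only [hu, RCLike.ofReal_one] at hf2
  have hfb' : f b' = 0 := by simp [hb', hf2]
  obtain ⟨g₀, -, hg₀⟩ := exists_dual_vector ℝ b' (norm_ne_zero_iff.mpr hb'0)
  set g := g₀ - g₀ u • f with hg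
  have hgu : g u = 0 := by simp [hg, hf2]
  have hg0 : g ≠ 0 := fun h => hb'0 <| by
    have : g b' = ‖b'‖ := by simp [hg, hg₀, hfb']
    rw [h] at this
    simpa using this.symm
  refine ⟨f, ‖g‖⁻¹ • g, hf1, ?_, fun a => ?_⟩
  · rw [norm_smul, norm_inv, norm_norm, inv_mul_cancel₀ (norm_ne_zero_iff.mpr hg0)]
  · have := (le_abs_self _).trans ((f + a • ‖g‖⁻¹ • g).le_opNorm u)
    simpa [hf2, hgu, hu] using this

theorem sq_le_mul_modulusOfSmoothness_dual (hdim : 2 ≤ Module.rank ℝ X) {τ : ℝ} (hτ0 : 0 < τ)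
    (hτ1 : τ ≤ 1) : τ ^ 2 ≤ 14 * modulusOfSmoothness (StrongDual ℝ X) τ := by
  obtain ⟨f, g, hf, hg, h⟩ := exists_dual_orthogonal_pair hdim
  exact sq_le_mul_modulusOfSmoothness hf hg h hτ0 hτ1

/-- The dual of a uniformly convex space is uniformly smooth. -/
theorem exists_modulusOfSmoothness_dual_le [CompleteSpace X] [UniformConvexSpace X] [Nontrivial X]
    {ε : ℝ} (hε : 0 < ε) :
    ∃ δ > 0, ∀ τ, 0 < τ → τ ≤ δ → modulusOfSmoothness (StrongDual ℝ X) τ ≤ ε * τ := by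
  obtain ⟨δ, hδ, h⟩ := exists_forall_sphere_dist_add_le_two_sub X hε
  refine ⟨δ / 2, by positivity, fun τ hτ0 hτ => modulusOfSmoothness_le fun f g hf hg => ?_⟩
  have hex : ∀ f : StrongDual ℝ X, ∃ u : X, ‖u‖ = 1 ∧ f u = ‖f‖ := fun f => by
    by_cases hf : f = 0
    · obtain ⟨u, hu⟩ := exists_norm_eq X zero_le_one
      exact ⟨u, hu, by simp [hf]⟩
    · exact exists_norm_one_apply_eq_norm hf
  -- With norming vectors the sum of norms is `f (u + v) + τ * g (u - v)`. Either `u` and `v` are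
  -- close, or uniform convexity loses `δ` while the second term gains at most `2 * τ ≤ δ`.
  obtain ⟨u, hu1, hu2⟩ := hex (f + τ • g)
  obtain ⟨v, hv1, hv2⟩ := hex (f - τ • g)
  rw [← hu2, ← hv2]
  have h1 : f (u + v) ≤ ‖u + v‖ := by simpa [hf] using (le_abs_self _).trans (f.le_opNorm (u + v))
  have h2 : g (u - v) ≤ ‖u - v‖ := by simpa [hg] using (le_abs_self _).trans (g.le_opNorm (u - v))
  rw [map_add] at h1
  rw [map_sub] at h2
  have h3 := mul_le_mul_of_nonneg_left h2 hτ0.le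
  simp only [add_apply, sub_apply, smul_apply, smul_eq_mul]
  rcases le_or_gt ε ‖u - v‖ with h' | h'
  · have h4 := h hu1 hv1 h'
    have h5 : ‖u - v‖ ≤ 2 := by
      have := norm_sub_le u v
      rw [hu1, hv1] at this
      linarith
    nlinarith [mul_pos hε hτ0]
  · have h4 := norm_add_le u v
    rw [hu1, hv1] at h4
    nlinarith [mul_pos hε hτ0]

/-- The function `ρ(τ) / τ` takes on `(0, 1]` all values in `(0, ρ(1)]`. -/
theorem exists_modulusOfSmoothness_dual_div_eq [CompleteSpace X] [UniformConvexSpace X]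
    [Nontrivial X] {m : ℝ} (hm0 : 0 < m) (hm : m ≤ modulusOfSmoothness (StrongDual ℝ X) 1) :
    ∃ τ, 0 < τ ∧ τ ≤ 1 ∧ modulusOfSmoothness (StrongDual ℝ X) τ / τ = m := by
  have : Nontrivial (StrongDual ℝ X) := by
    obtain ⟨u, hu⟩ := exists_ne (0 : X)
    obtain ⟨f, hf, -⟩ := exists_dual_vector' ℝ u
    exact nontrivial_of_ne f 0 (by rw [← norm_ne_zero_iff, hf]; norm_num)
  obtain ⟨δ, hδ, h⟩ := exists_modulusOfSmoothness_dual_le (X := X) hm0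
  set σ := min δ 1 with hσ
  have hσ0 : 0 < σ := lt_min hδ one_pos
  have hcont : ContinuousOn (fun τ => modulusOfSmoothness (StrongDual ℝ X) τ / τ) (Set.Icc σ 1) :=
    (continuous_modulusOfSmoothness _).continuousOn.div continuousOn_id
      fun τ hτ => (hσ0.trans_le hτ.1).ne'
  -- Uniform smoothness puts the quotient at `σ` below `m`; at 1 it is `ρ(1) ≥ m`.
  obtain ⟨τ, hτ, hτm⟩ := intermediate_value_Icc (min_le_right _ _) hcont
    ⟨(div_le_iff₀ hσ0).mpr (h σ hσ0 (min_le_left _ _)), by simpa using hm⟩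
  exact ⟨τ, hσ0.trans_le hτ.1, hτ.2, hτm⟩

end DualModulus

/-! ### Upper estimate for powers of the dual norm -/

section Inequality

theorem rpow_sub_rpow_le {a b q : ℝ} (ha : 0 ≤ a) (hb : 0 ≤ b) (hq : 1 < q) :
    1 / q * a ^ q - 1 / q * b ^ q ≤ a ^ (q - 1) * (a - b) := by
  have hpq := (Real.HolderConjugate.conjExponent hq).symm
  have h := Real.young_inequality_of_nonneg hb (Real.rpow_nonneg ha (q - 1)) hpq.symm
  rw [← Real.rpow_mul ha, hpq.symm.sub_one_mul_conj] at h
  have h1 := rpow_sub_one_mul_self ha hq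
  have h2 := hpq.inv_add_inv_eq_one
  have h3 : a ^ q = a ^ q / q.conjExponent + a ^ q / q := by
    rw [div_eq_mul_inv, div_eq_mul_inv, ← mul_add, h2, mul_one]
  have e1 : 1 / q * a ^ q = a ^ q / q := by ring
  have e2 : 1 / q * b ^ q = b ^ q / q := by ring
  rw [mul_sub, h1, e1, e2]
  linarith

/-- For `q ≤ 2` the power is compared with its base; for `q > 2` the chord over `[1, 2]` serves `u ≥
0`, and Bernoulli's inequality serves `u < 0`. -/
theorem one_add_rpow_sub_one_mul_le {q u : ℝ} (hq : 1 < q) (hu1 : -1 ≤ u) (hu2 : u ≤ 1) :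
    u * ((1 + u) ^ (q - 1) - 1) ≤ 2 ^ (q - 1) * u ^ 2 := by
  have h2 : (1 : ℝ) ≤ 2 ^ (q - 1) := Real.one_le_rpow one_le_two (by linarith)
  rcases le_or_gt 0 u with hu | hu
  · suffices (1 + u) ^ (q - 1) - 1 ≤ 2 ^ (q - 1) * u by nlinarith
    rcases le_or_gt (q - 1) 1 with h | h
    · have : (1 + u) ^ (q - 1) ≤ 1 + u := by
        simpa using Real.rpow_le_rpow_of_exponent_le (by linarith : 1 ≤ 1 + u) h
      nlinarith
    · have := (convexOn_rpow h.le).2 (x := 1) (y := 2) (by simp) (by simp)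
        (by linarith : 0 ≤ 1 - u) hu (by ring)
      simp only [smul_eq_mul, mul_one, Real.one_rpow] at this
      rw [show 1 - u + u * 2 = 1 + u by ring] at this
      nlinarith
  · suffices 2 ^ (q - 1) * u ≤ (1 + u) ^ (q - 1) - 1 by nlinarith
    rcases le_or_gt (q - 1) 1 with h | h
    · have : 1 + u ≤ (1 + u) ^ (q - 1) := by
        simpa using Real.rpow_le_rpow_of_exponent_ge' (by linarith) (by linarith)
          (by linarith : 0 ≤ q - 1) h
      nlinarith
    · have h3 := one_add_mul_self_le_rpow_one_add hu1 h.le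
      have h4 := one_add_mul_self_le_rpow_one_add (by norm_num : (-1 : ℝ) ≤ 1) h.le
      norm_num at h4
      nlinarith

variable {X : Type*} [NormedAddCommGroup X] [NormedSpace ℝ X]

theorem norm_sub_rpow_le_of_norm_eq_one (hdim : 2 ≤ Module.rank ℝ X) {q : ℝ} (hq : 1 < q)
    {f g : StrongDual ℝ X} {u : X} {τ : ℝ} (hτ0 : 0 < τ) (hτ1 : τ ≤ 1) (hf : ‖f‖ = 1)
    (hg : ‖g‖ = 1) (hu : ‖u‖ = 1) (hfu : f u = 1) :
    1 / q * ‖f - τ • g‖ ^ q ≤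
      1 / q - τ * g u + 2 ^ q * 8 * modulusOfSmoothness (StrongDual ℝ X) τ := by
  set ρ := modulusOfSmoothness (StrongDual ℝ X) τ with hρ
  set a := ‖f - τ • g‖ with ha
  have ha2 : a ≤ 2 := by
    have := norm_sub_le f (τ • g)
    rw [norm_smul, hf, hg, Real.norm_of_nonneg hτ0.le] at this
    linarith
  have hgu : |g u| ≤ 1 := by simpa [hg, hu] using g.le_opNorm u
  set v := -(τ * g u) with hv
  have hvτ : |v| ≤ τ := by
    rw [hv, abs_neg, abs_mul, abs_of_pos hτ0]
    nlinarith
  obtain ⟨hv1, hv2⟩ := abs_le.mp hvτ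
  have hva : 1 + v ≤ a := by
    have := (le_abs_self _).trans ((f - τ • g).le_opNorm u)
    simp only [sub_apply, smul_apply, smul_eq_mul, hfu, hu, mul_one] at this
    linarith
  -- The modulus bounds the sum of the two norms, and `‖f + τ • g‖ ≥ 1 - v` by evaluation at `u`.
  have hav : a ≤ 1 + v + 2 * ρ := by
    have h1 := norm_add_smul_add_norm_sub_smul_le hf hg τ
    have h2 := (le_abs_self _).trans ((f + τ • g).le_opNorm u)
    simp only [add_apply, smul_apply, smul_eq_mul, hfu, hu, mul_one] at h2
    linarith
  have hsq := sq_le_mul_modulusOfSmoothness_dual hdim hτ0 hτ1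
  rw [← hρ] at hsq
  have hvsq : v ^ 2 ≤ 14 * ρ := by nlinarith
  -- Tangent inequalities lead from `a` to `1 + v` and on to `1`. The errors `2 ^ (q - 1) * 2ρ` and
  -- `2 ^ (q - 1) * 14ρ` add up to `2 ^ q * 8ρ`.
  have b1 := rpow_sub_rpow_le (norm_nonneg (f - τ • g)) (by linarith : 0 ≤ 1 + v) hq
  have b2 := rpow_sub_rpow_le (by linarith : 0 ≤ 1 + v) zero_le_one hq
  have b3 := one_add_rpow_sub_one_mul_le hq (by linarith : -1 ≤ v) (by linarith)
  rw [← ha] at b1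
  rw [Real.one_rpow, mul_one, add_sub_cancel_left] at b2
  have hpow : a ^ (q - 1) ≤ 2 ^ (q - 1) :=
    Real.rpow_le_rpow (norm_nonneg _) ha2 (by linarith)
  have b4 : a ^ (q - 1) * (a - (1 + v)) ≤ 2 ^ (q - 1) * (2 * ρ) := by
    gcongr
    linarith
  have h2q : (2 : ℝ) ^ q = 2 ^ (q - 1) * 2 := (rpow_sub_one_mul_self zero_le_two hq).symm
  have b5 : (2 : ℝ) ^ (q - 1) * v ^ 2 ≤ 2 ^ (q - 1) * (14 * ρ) := by gcongr
  rw [h2q]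
  linarith

theorem norm_sub_smul_rpow_le (hdim : 2 ≤ Module.rank ℝ X) {q : ℝ} (hq : 1 < q)
    {f g : StrongDual ℝ X} {x : X} {τ : ℝ} (hτ0 : 0 < τ) (hτ1 : τ ≤ 1) (hf : f ≠ 0)
    (hg : g ≠ 0) (hx : x ∈ dualityMapDual q f) :
    1 / q * ‖f - (τ * ‖f‖ / ‖g‖) • g‖ ^ q ≤ 1 / q * ‖f‖ ^ q - (τ * ‖f‖ / ‖g‖) * g x +
      2 ^ q * 8 * modulusOfSmoothness (StrongDual ℝ X) τ * ‖f‖ ^ q := by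
  obtain ⟨u, hu1, hu2, rfl⟩ := exists_norming_of_mem_dualityMapDual hq hf hx
  have hf0 : 0 < ‖f‖ := norm_pos_iff.mpr hf
  have hg0 : 0 < ‖g‖ := norm_pos_iff.mpr hg
  have h := norm_sub_rpow_le_of_norm_eq_one hdim hq hτ0 hτ1 (f := ‖f‖⁻¹ • f) (g := ‖g‖⁻¹ • g)
    (u := u) (by rw [norm_smul, norm_inv, norm_norm, inv_mul_cancel₀ hf0.ne'])
    (by rw [norm_smul, norm_inv, norm_norm, inv_mul_cancel₀ hg0.ne']) hu1
    (by rw [smul_apply, hu2, smul_eq_mul, inv_mul_cancel₀ hf0.ne'])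
  have e : f - (τ * ‖f‖ / ‖g‖) • g = ‖f‖ • (‖f‖⁻¹ • f - τ • ‖g‖⁻¹ • g) := by
    rw [smul_sub, smul_inv_smul₀ hf0.ne', smul_smul, smul_smul]
    congr 2
    ring
  rw [e, norm_smul, norm_norm, Real.mul_rpow hf0.le (norm_nonneg _), map_smul, smul_eq_mul]
  have h' := mul_le_mul_of_nonneg_left h (Real.rpow_nonneg hf0.le q)
  have e2 : τ * ‖f‖ / ‖g‖ * (‖f‖ ^ (q - 1) * g u) = ‖f‖ ^ q * (τ * (‖g‖⁻¹ • g) u) := by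
    rw [← rpow_sub_one_mul_self hf0.le hq, smul_apply, smul_eq_mul]
    ring
  rw [e2]
  linarith

end Inequality

/-! ### The line search functional: derivative, Bregman distance, minimizers -/

section LineSearch

variable {X : Type*} [NormedAddCommGroup X] [NormedSpace ℝ X]
  {p q : ℝ} {x : X} {m : ℕ} {ψ : Fin m → StrongDual ℝ X} {β : Fin m → ℝ}

theorem dualStep_zero : dualStep p x ψ 0 = J p x := by simp [dualStep]

theorem lineSearch_zero : lineSearch p q x ψ β 0 = 1 / q * ‖J p x‖ ^ q := by
  simp [lineSearch, dualStep_zero]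

theorem sum_lastStep_smul {M : Type*} [AddCommGroup M] [Module ℝ M] (hm : 0 < m) (ν : ℝ)
    (v : Fin m → M) : ∑ k, lastStep m ν k • v k = ν • v ⟨m - 1, by omega⟩ := by
  rw [Finset.sum_eq_single ⟨m - 1, by omega⟩]
  · simp [lastStep, Nat.sub_add_cancel hm]
  · intro k _ hk
    have : ¬ ((k : ℕ) + 1 = m) := fun h => hk (Fin.ext (by simp; omega))
    simp [lastStep, this]
  · simp

theorem lineSearch_lastStep (hm : 0 < m) (ν : ℝ) :
    lineSearch p q x ψ β (lastStep m ν) =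
      1 / q * ‖J p x - ν • ψ ⟨m - 1, by omega⟩‖ ^ q + ν * β ⟨m - 1, by omega⟩ := by
  have h := sum_lastStep_smul hm ν β
  simp only [smul_eq_mul] at h
  rw [lineSearch, dualStep, sum_lastStep_smul hm ν ψ, h]

theorem hasDerivAt_lineSearch [CompleteSpace X] [UniformConvexSpace X]
    (hpq : p.HolderConjugate q) {t : Fin m → ℝ} {x' : X}
    (hx' : x' ∈ dualityMapDual q (dualStep p x ψ t)) (e : Fin m → ℝ) :
    HasDerivAt (fun c : ℝ => lineSearch p q x ψ β (t + c • e)) (∑ k, e k * (β k - ψ k x')) 0 := by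
  have hstep : ∀ c : ℝ, dualStep p x ψ (t + c • e) = dualStep p x ψ t - c • ∑ k, e k • ψ k := by
    intro c
    simp only [dualStep, Pi.add_apply, Pi.smul_apply, smul_eq_mul, add_smul, mul_smul,
      Finset.sum_add_distrib, Finset.smul_sum]
    abel
  have hsum : ∀ c : ℝ, ∑ k, (t + c • e) k * β k = ∑ k, t k * β k + c * ∑ k, e k * β k := by
    intro c
    simp only [Pi.add_apply, Pi.smul_apply, smul_eq_mul, add_mul, mul_assoc,
      Finset.sum_add_distrib, Finset.mul_sum]
  simp only [lineSearch, hstep, hsum]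
  have h1 : HasDerivAt (fun c : ℝ => dualStep p x ψ t - c • ∑ k, e k • ψ k)
      (-((1 : ℝ) • ∑ k, e k • ψ k)) 0 :=
    ((hasDerivAt_id (0 : ℝ)).smul_const _).const_sub _
  have h2 : HasFDerivAt (fun f' : StrongDual ℝ X => 1 / q * ‖f'‖ ^ q)
      (NormedSpace.inclusionInDoubleDual ℝ X x')
      (dualStep p x ψ t - (0 : ℝ) • ∑ k, e k • ψ k) := by
    rw [zero_smul, sub_zero]
    exact hasFDerivAt_norm_rpow_of_mem_dualityMapDual hpq hx'
  have h3 : HasDerivAt (fun c : ℝ => ∑ k, t k * β k + c * ∑ k, e k * β k)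
      (1 * ∑ k, e k * β k) 0 :=
    ((hasDerivAt_id (0 : ℝ)).mul_const _).const_add _
  refine ((h2.comp_hasDerivAt (0 : ℝ) h1).add h3).congr_deriv ?_
  rw [NormedSpace.dual_def, neg_apply, one_smul, one_mul, sum_apply]
  simp only [smul_apply, smul_eq_mul, mul_sub, Finset.sum_sub_distrib]
  ring

/-- Fermat's rule in each coordinate: the updated point lies on every hyperplane of the window. -/
theorem apply_eq_of_isMinimizer [CompleteSpace X] [UniformConvexSpace X]
    (hpq : p.HolderConjugate q) {t : Fin m → ℝ} (ht : IsMinimizer (lineSearch p q x ψ β) t) {x' : X}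
    (hx' : x' ∈ dualityMapDual q (dualStep p x ψ t)) (k : Fin m) : ψ k x' = β k := by
  have h := hasDerivAt_lineSearch (β := β) hpq hx' (Pi.single k 1)
  have hmin : IsLocalMin (fun c : ℝ => lineSearch p q x ψ β (t + c • Pi.single k 1)) 0 :=
    Eventually.of_forall fun c => by simpa using ht _
  have h0 := hmin.hasDerivAt_eq_zero h
  rw [Finset.sum_eq_single k (by
    intro i _ hi
    simp [Pi.single_eq_of_ne hi]) (by simp)] at h0
  simp only [Pi.single_eq_same, one_mul] at h0
  linarith

/-- The line search functional and the Bregman distance to a solution differ by a constant. -/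
theorem lineSearch_sub_eq_bregmanDist_sub (hX : IsSmooth X) (hpq : p.HolderConjugate q)
    {z : X} (hβ : ∀ k, β k = ψ k z) {t : Fin m → ℝ} {x' : X}
    (hx' : x' ∈ dualityMapDual q (dualStep p x ψ t)) :
    lineSearch p q x ψ β t - lineSearch p q x ψ β 0 = bregmanDist p x' z - bregmanDist p x z := by
  have key : ∀ {f : StrongDual ℝ X} {w : X}, w ∈ dualityMapDual q f →
      bregmanDist p w z = 1 / p * ‖z‖ ^ p + 1 / q * ‖f‖ ^ q - f z := fun {f w} hw => by
    rw [bregmanDist, J_eq_of_mem_dualityMapDual hX hpq hw, map_sub,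
      (mem_dualityMapDual_iff.mp hw).1, norm_rpow_eq_of_mem_dualityMapDual hpq hw]
    have : ‖f‖ ^ q = 1 / p * ‖f‖ ^ q + 1 / q * ‖f‖ ^ q := by
      rw [← add_mul, one_div, one_div, hpq.inv_add_inv_eq_one, one_mul]
    linarith
  rw [key hx', key (mem_dualityMapDual_J hpq x), lineSearch_zero, lineSearch]
  have : dualStep p x ψ t z = J p x z - ∑ k, t k * β k := by
    simp [dualStep, hβ, sub_apply, sum_apply]
  rw [this]
  ring

theorem lineSearch_le_iff_bregmanDist_le (hX : IsSmooth X) (hpq : p.HolderConjugate q)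
    {z : X} (hβ : ∀ k, β k = ψ k z) {t : Fin m → ℝ} {x' : X}
    (hx' : x' ∈ dualityMapDual q (dualStep p x ψ t)) (S : ℝ) :
    lineSearch p q x ψ β t ≤ lineSearch p q x ψ β 0 - S ↔
      bregmanDist p x' z ≤ bregmanDist p x z - S := by
  have := lineSearch_sub_eq_bregmanDist_sub hX hpq hβ hx'
  constructor <;> intro h <;> linarith

theorem exists_isMinimizer_lineSearch (hpq : p.HolderConjugate q) (hψ : LinearIndependent ℝ ψ)
    {z : X} (hβ : ∀ k, β k = ψ k z) : ∃ t, IsMinimizer (lineSearch p q x ψ β) t := by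
  have hcont : Continuous (lineSearch p q x ψ β) := by
    have h : Continuous fun t : Fin m → ℝ => ‖dualStep p x ψ t‖ ^ q := by
      unfold dualStep
      exact Continuous.rpow_const (by fun_prop) fun _ => Or.inr hpq.symm.nonneg
    unfold lineSearch
    fun_prop
  refine hcont.exists_forall_le ?_
  obtain ⟨K, hK0, hK⟩ := (Fintype.linearCombination ℝ ψ).exists_antilipschitzWith
    (LinearMap.ker_eq_bot.mpr (linearIndependent_iff_injective_fintypeLinearCombination.mp hψ))
  have hK' : (0 : ℝ) < K := hK0
  have hlim : Tendsto (fun t : Fin m → ℝ =>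
      (K : ℝ)⁻¹ * ‖t‖ - (‖J p x‖ + (‖z‖ + 1) ^ p / p - J p x z)) (cocompact _) atTop :=
    tendsto_atTop_add_const_right _ _
      ((tendsto_norm_cocompact_atTop (E := Fin m → ℝ)).const_mul_atTop (inv_pos.mpr hK'))
  refine tendsto_atTop_mono (fun t => ?_) hlim
  set f := dualStep p x ψ t with hf
  have h1 : ‖t‖ ≤ K * ‖∑ k, t k • ψ k‖ := by
    simpa [dist_eq_norm, Fintype.linearCombination_apply] using hK.le_mul_dist t 0
  have h2 : ‖∑ k, t k • ψ k‖ ≤ ‖J p x‖ + ‖f‖ := by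
    have : ∑ k, t k • ψ k = J p x - f := by simp [hf, dualStep]
    rw [this]
    exact norm_sub_le _ _
  -- Young's inequality with `‖z‖ + 1` in place of `‖z‖` absorbs `f z` and leaves one spare `‖f‖`,
  -- which gives coercivity.
  have h3 := Real.young_inequality_of_nonneg (norm_nonneg f)
    (by positivity : 0 ≤ ‖z‖ + 1) hpq.symm
  have h4 : f z ≤ ‖f‖ * ‖z‖ := (le_abs_self _).trans (f.le_opNorm z)
  have h5 : f z = J p x z - ∑ k, t k * β k := by
    simp [hf, dualStep, hβ, sub_apply, sum_apply]
  have h6 : (K : ℝ)⁻¹ * ‖t‖ ≤ ‖∑ k, t k • ψ k‖ := by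
    rwa [inv_mul_le_iff₀ hK']
  have e : ‖f‖ ^ q / q = 1 / q * ‖f‖ ^ q := by ring
  rw [lineSearch, ← hf]
  linarith

theorem isMinimizer_lineSearch_unique [CompleteSpace X] [UniformConvexSpace X] (hX : IsSmooth X)
    (hpq : p.HolderConjugate q) (hψ : LinearIndependent ℝ ψ) {t t' : Fin m → ℝ}
    (ht : IsMinimizer (lineSearch p q x ψ β) t) (ht' : IsMinimizer (lineSearch p q x ψ β) t') :
    t' = t := by
  obtain ⟨u, hu⟩ := exists_mem_dualityMapDual hpq.symm.lt (dualStep p x ψ t)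
  obtain ⟨v, hv⟩ := exists_mem_dualityMapDual hpq.symm.lt (dualStep p x ψ t')
  have hβ := apply_eq_of_isMinimizer hpq ht hu
  have heq : lineSearch p q x ψ β t = lineSearch p q x ψ β t' := le_antisymm (ht t') (ht' t)
  set f := dualStep p x ψ t with hf
  set g := dualStep p x ψ t' with hg
  have hfu : f u = J p x u - ∑ k, t k * β k := by
    simp [hf, dualStep, hβ, sub_apply, sum_apply]
  have hgu : g u = J p x u - ∑ k, t' k * β k := by
    simp [hg, dualStep, hβ, sub_apply, sum_apply]
  rw [lineSearch, lineSearch, ← hf, ← hg] at heq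
  -- By the subgradient inequality `f` minimizes this function, and equal line search values mean
  -- that `g` does too. Its derivative at `g` is `v - u`, so `u = v`.
  have hmin : IsLocalMin (fun f' : StrongDual ℝ X =>
      1 / q * ‖f'‖ ^ q - NormedSpace.inclusionInDoubleDual ℝ X u f') g :=
    Eventually.of_forall fun f' => by
      have := apply_sub_le_of_mem_dualityMapDual hpq hu f'
      rw [sub_apply] at this
      simp only [NormedSpace.dual_def]
      linarith
  have h0 := hmin.hasFDerivAt_eq_zero
    ((hasFDerivAt_norm_rpow_of_mem_dualityMapDual hpq hv).sub
      (NormedSpace.inclusionInDoubleDual ℝ X u).hasFDerivAt)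
  have huv : v = u :=
    (NormedSpace.inclusionInDoubleDualLi (E := X) ℝ).injective (sub_eq_zero.mp h0)
  have hfg : g = f := by
    rw [← J_eq_of_mem_dualityMapDual hX hpq hu, ← J_eq_of_mem_dualityMapDual hX hpq hv, huv]
  refine linearIndependent_iff_injective_fintypeLinearCombination.mp hψ ?_
  simpa [hf, hg, dualStep, Fintype.linearCombination_apply] using hfg

end LineSearch

/-! ### Directions produced by the method and their descent -/

section Run

variable {X Y : Type*} [NormedAddCommGroup X] [NormedSpace ℝ X]
  [NormedAddCommGroup Y] [NormedSpace ℝ Y]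
  {p q r : ℝ} {A : X →L[ℝ] Y} {y : Y} {jY : Y → StrongDual ℝ Y} {N : ℕ → ℕ} {x : ℕ → X}
  {ω : ℕ → StrongDual ℝ Y} {s t : ∀ k, Fin (N k) → ℝ} {n : ℕ}

theorem offsets_eq_searchDirs_apply {z : X} (hz : A z = y) (k : Fin (N n)) :
    offsets y N ω n k = searchDirs A N ω n k z := by
  subst hz
  rfl

theorem descentBy_of_le (hX : IsSmooth X) (hpq : p.HolderConjugate q) {w : X} {m : ℕ}
    {ψ : Fin m → StrongDual ℝ X} {β : Fin m → ℝ} (hβ : ∀ z, A z = y → ∀ k, β k = ψ k z) {ν S : ℝ}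
    (h : lineSearch p q w ψ β (lastStep m ν) ≤ lineSearch p q w ψ β 0 - S) :
    DescentBy p q A y w ψ β ν S :=
  ⟨h, fun _ ht => ⟨(ht _).trans h, fun _ hx' z hz =>
    (lineSearch_le_iff_bregmanDist_le hX hpq (hβ z hz) hx' S).mp ((ht _).trans h)⟩⟩

namespace IsRun

/-- The bound `N k ≤ k + 1` ensures that `k + 1 - N k` in the window is never truncated. -/
theorem card_pos_le (h : IsRun p q A y jY N x ω s t n) {k : ℕ} (hk : k ≤ n) :
    0 < N k ∧ N k ≤ k + 1 := by
  induction k with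
  | zero => simp [h.card_zero]
  | succ k ih =>
    have h1 := h.card_succ k (by omega)
    have h2 := ih (by omega)
    omega

theorem window_last (h : IsRun p q A y jY N x ω s t n) {k : ℕ} (hk : k ≤ n) {α : Type*}
    (u : ℕ → α) (hN : N k - 1 < N k) : window N u k ⟨N k - 1, hN⟩ = u k := by
  have := h.card_pos_le hk
  simp only [window]
  congr 1
  omega

/-- Optimality of the previous step makes every previous precursor vanish on the new residual, so
only the `jY` term survives. -/
theorem precursor_apply_residual [CompleteSpace X] [UniformConvexSpace X]
    (h : IsRun p q A y jY N x ω s t n) (hpq : p.HolderConjugate q)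
    (hjY : ∀ v, jY v ∈ dualityMap r v) {k : ℕ} (hk : k ≤ n) :
    ω k (A (x k) - y) = ‖A (x k) - y‖ ^ r := by
  rcases k with _ | k
  · rw [h.precursor_zero, (hjY _).1]
  · have h0 : ∀ i, window N ω k i (A (x (k + 1)) - y) = 0 := fun i => by
      have := apply_eq_of_isMinimizer hpq (h.step_min k hk) (h.update k hk) i
      rw [map_sub, sub_eq_zero]
      exact this
    simp [h.precursor_succ k hk, (hjY _).1, h0, sub_apply, sum_apply]

theorem direction_ne_zero [CompleteSpace X] [UniformConvexSpace X]
    (h : IsRun p q A y jY N x ω s t n) (hpq : p.HolderConjugate q) (hy : y ∈ Set.range A)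
    (hjY : ∀ v, jY v ∈ dualityMap r v) {k : ℕ} (hk : k ≤ n) : (ω k).comp A ≠ 0 := by
  obtain ⟨z, rfl⟩ := hy
  intro h0
  have h1 := h.precursor_apply_residual hpq hjY hk
  have h2 : (ω k).comp A (x k - z) = 0 := by simp [h0]
  rw [ContinuousLinearMap.comp_apply, map_sub, h1] at h2
  exact (Real.rpow_pos_of_pos (norm_pos_iff.mpr (h.residual_ne k hk)) r).ne' h2

theorem direction_succ_eq (h : IsRun p q A y jY N x ω s t n) {k : ℕ} (hk : k < n) :
    (ω (k + 1)).comp A =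
      (jY (A (x (k + 1)) - y)).comp A - ∑ i, s k i • searchDirs A N ω k i := by
  rw [h.precursor_succ k hk]
  ext v
  simp [searchDirs, window, sub_apply, sum_apply]

theorem norm_direction_succ_le (h : IsRun p q A y jY N x ω s t n) (hq : 1 < q) {k : ℕ} (hk : k < n)
    (c : Fin (N k) → ℝ) :
    ‖(ω (k + 1)).comp A‖ ≤
      ‖(jY (A (x (k + 1)) - y)).comp A - ∑ i, c i • searchDirs A N ω k i‖ := by
  have := h.coeff_min k hk c
  beta_reduce at this
  rw [← h.direction_succ_eq hk] at this
  exact (Real.rpow_le_rpow_iff (norm_nonneg _) (norm_nonneg _) (by linarith)).mp this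

theorem norm_direction_le (h : IsRun p q A y jY N x ω s t n) (hq : 1 < q)
    (hjY : ∀ v, jY v ∈ dualityMap r v) {k : ℕ} (hk : k ≤ n) :
    ‖(ω k).comp A‖ ≤ ‖A (x k) - y‖ ^ (r - 1) * ‖A‖ := by
  have hd : ‖(jY (A (x k) - y)).comp A‖ ≤ ‖A (x k) - y‖ ^ (r - 1) * ‖A‖ := by
    rw [← (hjY (A (x k) - y)).2]
    exact ContinuousLinearMap.opNorm_comp_le _ _
  refine le_trans ?_ hd
  rcases k with _ | k
  · rw [h.precursor_zero]
  · simpa using h.norm_direction_succ_le hq hk 0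

/-- Indexing by iteration numbers lets consecutive windows be compared as sets: each lies in the
previous one plus the new index. -/
theorem linearIndepOn_directions [CompleteSpace X] [UniformConvexSpace X]
    (h : IsRun p q A y jY N x ω s t n) (hpq : p.HolderConjugate q) (hy : y ∈ Set.range A)
    (hjY : ∀ v, jY v ∈ dualityMap r v) {k : ℕ} (hk : k ≤ n) :
    LinearIndepOn ℝ (fun k => (ω k).comp A) (Set.Ico (k + 1 - N k) (k + 1)) := by
  induction k with
  | zero =>
    have : Set.Ico (0 + 1 - N 0) (0 + 1) ⊆ insert 0 ∅ := fun i hi => by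
      have := hi.2
      simp
      omega
    refine LinearIndepOn.mono (LinearIndepOn.insert (linearIndepOn_empty ℝ _) ?_) this
    simpa using h.direction_ne_zero hpq hy hjY hk
  | succ k ih =>
    have hsub : Set.Ico (k + 1 + 1 - N (k + 1)) (k + 1 + 1) ⊆
        insert (k + 1) (Set.Ico (k + 1 - N k) (k + 1)) := fun i hi => by
      have h1 := (h.card_succ k hk).2
      have h2 := hi.1
      have h3 := hi.2
      rw [Set.mem_insert_iff, Set.mem_Ico]
      omega
    refine LinearIndepOn.mono (LinearIndepOn.insert (ih (by omega)) fun hmem => ?_) hsub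
    have hrange : (fun k => (ω k).comp A) '' Set.Ico (k + 1 - N k) (k + 1) ⊆
        Set.range (searchDirs A N ω k) := by
      rintro _ ⟨i, hi, rfl⟩
      have h1 := hi.1
      have h2 := hi.2
      refine ⟨⟨i - (k + 1 - N k), by omega⟩, ?_⟩
      simp only [searchDirs, window]
      congr 2
      omega
    have hmem' := Submodule.span_mono hrange hmem
    obtain ⟨c, hc⟩ := (Submodule.mem_span_range_iff_exists_fun ℝ).mp hmem'
    -- If the new direction were `∑ i, c i • ψ i`, the coefficients `s k + c` would reproduce the
    -- Landweber direction exactly, and minimality would make the new direction zero.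
    have hle := h.norm_direction_succ_le hpq.symm.lt hk (s k + c)
    have heq : (jY (A (x (k + 1)) - y)).comp A -
        ∑ i, (s k + c) i • searchDirs A N ω k i = 0 := by
      simp only [Pi.add_apply, add_smul, Finset.sum_add_distrib, hc]
      rw [h.direction_succ_eq hk]
      abel
    rw [heq, norm_zero] at hle
    exact h.direction_ne_zero hpq hy hjY hk (norm_le_zero_iff.mp hle)

theorem linearIndependent_searchDirs [CompleteSpace X] [UniformConvexSpace X]
    (h : IsRun p q A y jY N x ω s t n) (hpq : p.HolderConjugate q) (hy : y ∈ Set.range A)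
    (hjY : ∀ v, jY v ∈ dualityMap r v) : LinearIndependent ℝ (searchDirs A N ω n) := by
  have hN := h.card_pos_le le_rfl
  refine (h.linearIndepOn_directions hpq hy hjY le_rfl).linearIndependent.comp
    (fun i : Fin (N n) => (⟨n + 1 - N n + i, by omega, by omega⟩ :
      Set.Ico (n + 1 - N n) (n + 1))) fun i j hij => ?_
  have := congrArg Subtype.val hij
  simp only at this
  exact Fin.ext (by omega)

/-- The new direction separates the iterate from the solutions. -/
theorem direction_apply_iterate [CompleteSpace X] [UniformConvexSpace X]
    (h : IsRun p q A y jY N x ω s t n) (hpq : p.HolderConjugate q)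
    (hjY : ∀ v, jY v ∈ dualityMap r v) :
    (ω n).comp A (x n) = ω n y + ‖A (x n) - y‖ ^ r := by
  rw [← h.precursor_apply_residual hpq hjY le_rfl, map_sub, ContinuousLinearMap.comp_apply]
  ring

theorem lineSearch_lastStep (h : IsRun p q A y jY N x ω s t n) (ν : ℝ) :
    lineSearch p q (x n) (searchDirs A N ω n) (offsets y N ω n) (lastStep (N n) ν) =
      1 / q * ‖J p (x n) - ν • (ω n).comp A‖ ^ q + ν * ω n y := by
  rw [SESOP.lineSearch_lastStep (h.card_pos_le le_rfl).1, searchDirs, h.window_last le_rfl,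
    offsets, h.window_last le_rfl]

/-- The derivative at 0 along the last coordinate is `ω n y - (ω n).comp A (x n) = -R ^ r < 0`. -/
theorem exists_lineSearch_lastStep_lt [CompleteSpace X] [UniformConvexSpace X]
    (h : IsRun p q A y jY N x ω s t n) (hpq : p.HolderConjugate q)
    (hjY : ∀ v, jY v ∈ dualityMap r v) :
    ∃ ν > 0, lineSearch p q (x n) (searchDirs A N ω n) (offsets y N ω n) (lastStep (N n) ν) <
      lineSearch p q (x n) (searchDirs A N ω n) (offsets y N ω n) 0 := by
  set φ : ℝ → ℝ := fun ν =>
    lineSearch p q (x n) (searchDirs A N ω n) (offsets y N ω n) (lastStep (N n) ν) with hφ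
  have hder : HasDerivAt φ (-‖A (x n) - y‖ ^ r) 0 := by
    have h1 := hasDerivAt_lineSearch (β := offsets y N ω n) hpq (t := 0)
      (ψ := searchDirs A N ω n) (by rw [dualStep_zero]; exact mem_dualityMapDual_J hpq (x n))
      (lastStep (N n) 1)
    have h2 := sum_lastStep_smul (h.card_pos_le le_rfl).1 1
      (fun k => offsets y N ω n k - searchDirs A N ω n k (x n))
    simp only [smul_eq_mul, one_mul] at h2
    rw [h2, searchDirs, h.window_last le_rfl, offsets, h.window_last le_rfl,
      h.direction_apply_iterate hpq hjY] at h1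
    refine (h1.congr_deriv (by ring)).congr_of_eventuallyEq (Eventually.of_forall fun c => ?_)
    simp only [hφ]
    congr 1
    ext k
    simp [lastStep]
  have hneg : -‖A (x n) - y‖ ^ r < 0 :=
    neg_neg_of_pos (Real.rpow_pos_of_pos (norm_pos_iff.mpr (h.residual_ne n le_rfl)) r)
  have hev := (hasDerivAt_iff_tendsto_slope.mp hder).eventually_lt_const hneg
  have hev' : ∀ᶠ ν in 𝓝[>] (0 : ℝ), slope φ 0 ν < 0 :=
    hev.filter_mono (nhdsWithin_mono _ fun _ hν => ne_of_gt hν)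
  obtain ⟨ν, hν1, hν2⟩ := (hev'.and self_mem_nhdsWithin).exists
  have hν : (0 : ℝ) < ν := hν2
  refine ⟨ν, hν, ?_⟩
  rw [slope_def_field, sub_zero, div_neg_iff] at hν1
  have h0 : φ 0 = lineSearch p q (x n) (searchDirs A N ω n) (offsets y N ω n) 0 := by
    simp only [hφ]
    congr 1
    ext k
    simp [lastStep]
  rw [← h0]
  rcases hν1 with hν1 | hν1 <;> linarith

theorem lineSearch_lastStep_le [CompleteSpace X] [UniformConvexSpace X]
    (h : IsRun p q A y jY N x ω s t n) (hpq : p.HolderConjugate q) (hr : 1 < r)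
    (hy : y ∈ Set.range A) (hjY : ∀ v, jY v ∈ dualityMap r v) (hdim : 2 ≤ Module.rank ℝ X)
    (hx : x n ≠ 0) {γ : ℝ} (hγ1 : γ < 1) {τ : ℝ}
    (hτ : IsStepParameter p q r γ ‖A (x n) - y‖ (x n) ((ω n).comp A) τ) :
    lineSearch p q (x n) (searchDirs A N ω n) (offsets y N ω n)
        (lastStep (N n) (τ * ‖x n‖ ^ (p - 1) / ‖(ω n).comp A‖)) ≤
      lineSearch p q (x n) (searchDirs A N ω n) (offsets y N ω n) 0 -
        (1 - γ) / ‖A‖ * τ * ‖x n‖ ^ (p - 1) * ‖A (x n) - y‖ := by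
  obtain ⟨hτ0, hτ1, hτρ⟩ := hτ
  have hψ := h.direction_ne_zero hpq hy hjY le_rfl
  have hψle := h.norm_direction_le hpq.symm.lt hjY le_rfl
  have hψx := h.direction_apply_iterate hpq hjY
  set ψ := (ω n).comp A with hψdef
  set R := ‖A (x n) - y‖ with hR
  set ρ := modulusOfSmoothness (StrongDual ℝ X) τ with hρ
  have hψ0 : 0 < ‖ψ‖ := norm_pos_iff.mpr hψ
  have hR0 : 0 < R := norm_pos_iff.mpr (h.residual_ne n le_rfl)
  have hx0 : 0 < ‖x n‖ := norm_pos_iff.mpr hx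
  have hA0 : 0 < ‖A‖ := norm_pos_iff.mpr fun hA => hψ (by simp [hψdef, hA])
  have hJ := J_mem hpq.lt (x n)
  have hJn : ‖J p (x n)‖ = ‖x n‖ ^ (p - 1) := hJ.2
  have hJ0 : J p (x n) ≠ 0 := by
    rw [← norm_ne_zero_iff, hJn]
    exact (Real.rpow_pos_of_pos hx0 _).ne'
  have hJq : ‖J p (x n)‖ ^ q = ‖x n‖ ^ (p - 1) * ‖x n‖ := by
    rw [← norm_rpow_eq_of_mem_dualityMapDual hpq (mem_dualityMapDual_J hpq (x n)),
      rpow_sub_one_mul_self hx0.le hpq.lt]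
  have hmain := norm_sub_smul_rpow_le hdim hpq.symm.lt hτ0 hτ1 hJ0 hψ (mem_dualityMapDual_J hpq (x n))
  rw [h.lineSearch_lastStep, lineSearch_zero]
  rw [hJq, hJn, hψx] at hmain
  rw [hJq]
  set a := ‖x n‖ ^ (p - 1) with ha
  have ha0 : 0 < a := Real.rpow_pos_of_pos hx0 _
  -- The entry 8 of the maximum already matches the constant of the norm estimate.
  have hG : 8 ≤ xuRoachG p q := le_max_left _ _
  have h2q : (0 : ℝ) < 2 ^ q := Real.rpow_pos_of_pos two_pos _
  have hρle : 2 ^ q * 8 * ρ ≤ τ * γ * (R ^ r / (‖x n‖ * ‖ψ‖)) := by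
    have h1 : ρ / τ ≤ γ / (2 ^ q * xuRoachG p q) * (R ^ r / (‖x n‖ * ‖ψ‖)) :=
      hτρ.trans_le (min_le_right _ _)
    rw [div_le_iff₀ hτ0] at h1
    have hρ0 : 0 ≤ ρ := by
      have := sq_le_mul_modulusOfSmoothness_dual hdim hτ0 hτ1
      have := sq_nonneg τ
      linarith
    calc 2 ^ q * 8 * ρ ≤ 2 ^ q * xuRoachG p q * ρ := by gcongr
      _ ≤ 2 ^ q * xuRoachG p q *
          (γ / (2 ^ q * xuRoachG p q) * (R ^ r / (‖x n‖ * ‖ψ‖)) * τ) := by gcongr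
      _ = τ * γ * (R ^ r / (‖x n‖ * ‖ψ‖)) := by
        have : xuRoachG p q ≠ 0 := by linarith
        field_simp
  have herr : 2 ^ q * 8 * ρ * (a * ‖x n‖) ≤ γ * (τ * a / ‖ψ‖ * R ^ r) := by
    calc 2 ^ q * 8 * ρ * (a * ‖x n‖) ≤ τ * γ * (R ^ r / (‖x n‖ * ‖ψ‖)) * (a * ‖x n‖) := by gcongr
      _ = γ * (τ * a / ‖ψ‖ * R ^ r) := by field_simp
  have hdec : (1 - γ) / ‖A‖ * τ * a * R ≤ (1 - γ) * (τ * a / ‖ψ‖ * R ^ r) := by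
    -- This is `‖ψ‖ ≤ R ^ (r - 1) * ‖A‖`: projecting does not lengthen the Landweber direction.
    have h1 : R / ‖A‖ ≤ R ^ r / ‖ψ‖ := by
      rw [div_le_div_iff₀ hA0 hψ0, ← rpow_sub_one_mul_self hR0.le hr]
      nlinarith
    have h2 : 0 ≤ (1 - γ) * τ * a := mul_nonneg (mul_nonneg (by linarith) hτ0.le) ha0.le
    calc (1 - γ) / ‖A‖ * τ * a * R = (1 - γ) * τ * a * (R / ‖A‖) := by ring
      _ ≤ (1 - γ) * τ * a * (R ^ r / ‖ψ‖) := by gcongr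
      _ = (1 - γ) * (τ * a / ‖ψ‖ * R ^ r) := by ring
  linarith

end IsRun

end Run

end SESOP

theorem mainTheorem2
    {X Y : Type*}
    [NormedAddCommGroup X] [NormedSpace ℝ X] [CompleteSpace X] [UniformConvexSpace X]
    [NormedAddCommGroup Y] [NormedSpace ℝ Y] [CompleteSpace Y]
    (hX : IsSmooth X)
    (p q r : ℝ) (hpq : p.HolderConjugate q) (hr : 1 < r)
    (A : X →L[ℝ] Y) (y : Y) (hy : y ∈ Set.range A)
    (jY : Y → StrongDual ℝ Y) (hjY : ∀ v, jY v ∈ dualityMap r v)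
    (N : ℕ → ℕ) (x : ℕ → X) (ω : ℕ → StrongDual ℝ Y) (s t : ∀ k, Fin (N k) → ℝ)
    (n : ℕ) (hrun : IsRun p q A y jY N x ω s t n) :
    -- the new search direction is not zero
    (ω n).comp A ≠ 0 ∧
    -- the step vector exists and is unique
    (∃! tn : Fin (N n) → ℝ,
      IsMinimizer (lineSearch p q (x n) (searchDirs A N ω n) (offsets y N ω n)) tn) ∧
    -- every step vector defines a unique new iterate
    (∀ t' : Fin (N n) → ℝ,
      ∃! x' : X, x' ∈ dualityMapDual q (dualStep p (x n) (searchDirs A N ω n) t')) ∧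
    -- a decrease of the line search functional is the same as a decrease of the Bregman distance
    (∀ (t' : Fin (N n) → ℝ),
      ∀ x' ∈ dualityMapDual q (dualStep p (x n) (searchDirs A N ω n) t'),
      ∀ z, A z = y → ∀ S : ℝ,
        (lineSearch p q (x n) (searchDirs A N ω n) (offsets y N ω n) t' ≤
            lineSearch p q (x n) (searchDirs A N ω n) (offsets y N ω n) 0 - S ↔
          bregmanDist p x' z ≤ bregmanDist p (x n) z - S)) ∧
    -- descent
    (∃ ν > 0, ∃ S > 0,
      DescentBy p q A y (x n) (searchDirs A N ω n) (offsets y N ω n) ν S) ∧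
    -- descent with the explicit amount
    (2 ≤ Module.rank ℝ X → x n ≠ 0 → ∀ γ : ℝ, 0 < γ → γ < 1 →
      (∃ τ, IsStepParameter p q r γ ‖A (x n) - y‖ (x n) ((ω n).comp A) τ) ∧
      ∀ τ, IsStepParameter p q r γ ‖A (x n) - y‖ (x n) ((ω n).comp A) τ →
        0 < (1 - γ) / ‖A‖ * τ * ‖x n‖ ^ (p - 1) * ‖A (x n) - y‖ ∧
        DescentBy p q A y (x n) (searchDirs A N ω n) (offsets y N ω n)
          (τ * ‖x n‖ ^ (p - 1) / ‖(ω n).comp A‖)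
          ((1 - γ) / ‖A‖ * τ * ‖x n‖ ^ (p - 1) * ‖A (x n) - y‖)) := by
  have hψ := hrun.direction_ne_zero hpq hy hjY le_rfl
  have hli := hrun.linearIndependent_searchDirs hpq hy hjY
  have hβ : ∀ z, A z = y → ∀ k, offsets y N ω n k = searchDirs A N ω n k z :=
    fun z hz k => offsets_eq_searchDirs_apply hz k
  refine ⟨hψ, ?_, fun t' => existsUnique_mem_dualityMapDual hpq.symm.lt _,
    fun t' x' hx' z hz S => lineSearch_le_iff_bregmanDist_le hX hpq (hβ z hz) hx' S, ?_, ?_⟩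
  · obtain ⟨z, hz⟩ := hy
    obtain ⟨tn, htn⟩ := exists_isMinimizer_lineSearch (x := x n) hpq hli (hβ z hz)
    exact ⟨tn, htn, fun t' ht' => isMinimizer_lineSearch_unique hX hpq hli htn ht'⟩
  · obtain ⟨ν, hν, hlt⟩ := hrun.exists_lineSearch_lastStep_lt hpq hjY
    -- `S` is the whole decrease achieved by the step `ν`.
    exact ⟨ν, hν, _, sub_pos.mpr hlt, descentBy_of_le hX hpq hβ (by linarith)⟩
  · intro hdim hx γ hγ0 hγ1
    have : Nontrivial X := nontrivial_of_ne _ _ hx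
    have hR : 0 < ‖A (x n) - y‖ := norm_pos_iff.mpr (hrun.residual_ne n le_rfl)
    have hx0 : 0 < ‖x n‖ := norm_pos_iff.mpr hx
    have hψ0 : 0 < ‖(ω n).comp A‖ := norm_pos_iff.mpr hψ
    have hA0 : 0 < ‖A‖ := norm_pos_iff.mpr fun hA => hψ (by simp [hA])
    refine ⟨?_, fun τ hτ => ⟨?_, descentBy_of_le hX hpq hβ
      (hrun.lineSearch_lastStep_le hpq hr hy hjY hdim hx hγ1 hτ)⟩⟩
    · have hG : 0 < xuRoachG p q := lt_of_lt_of_le (by norm_num) (le_max_left _ _)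
      have hρ1 : 0 < modulusOfSmoothness (StrongDual ℝ X) 1 := by
        have := sq_le_mul_modulusOfSmoothness_dual hdim one_pos le_rfl
        linarith
      exact exists_modulusOfSmoothness_dual_div_eq
        (lt_min hρ1 (by positivity)) (min_le_left _ _)
    · have hτ0 := hτ.1
      have hγ : 0 < 1 - γ := sub_pos.mpr hγ1
      positivity
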